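/- Let $d\ge 5$ be an integer, let $\frac{2d}{d-4}<p\le\infty$ (with $d/p=0$ if $p=\infty$), and let $\mathbb T^d=\mathbb R^d/\mathbb Z^d$ with its normalized Lebesgue measure. For $f\in L^2(\mathbb T^d)$ and $\mathbf k\in\mathbb Z^d$ write $\mathcal F(f)(\mathbf k)=\int_{\mathbb T^d}f(x)e^{-2\pi i\mathbf k\cdot x}\,dx$, and for $R,\delta>0$ let $$P_{R,\delta}f(x)=\sum_{\mathbf k\in\mathbb Z^d,\ R-\delta/2\le|\mathbf k|\le R+\delta/2}\mathcal F(f)(\mathbf k)\,e^{2\pi i\mathbf k\cdot x}$$ be the spectral projector onto the frequencies in the annulus of radius $R$ and width $\delta$ ($|\cdot|$ is the Euclidean norm). Then for every $A\ge1$ there is a constant $C$, depending only on $d$, $p$ and $A$, such that for all real $N\ge1$, all $R$ with $N/A\le R\le AN$, all $\delta$ with $\frac1{AN}\le\delta\le1$, and all $f\in L^2(\mathbb T^d)$, $$\|P_{R,\delta}f\|_{L^p(\mathbb T^d)}\le C\,N^{\frac{d-1}{2}-\frac dp}\,\delta^{1/2}\,\|f\|_{L^2(\mathbb T^d)}.$$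 -/

import Mathlib

open MeasureTheory
open scoped ENNReal

noncomputable section

/-- The Euclidean length `|k|` of an integer vector `k`. -/
def latticeNorm {d : ℕ} (k : Fin d → ℤ) : ℝ :=
  Real.sqrt (∑ i, (k i : ℝ) ^ 2)

/-- The integer vectors in the closed annulus of (mid-)radius `R` and width `δ`,
i.e. those with `R - δ / 2 ≤ |k| ≤ R + δ / 2`. -/
def annulus (d : ℕ) (R δ : ℝ) : Set (Fin d → ℤ) :=
  {k | |latticeNorm k - R| ≤ δ / 2}

theorem annulus_finite (d : ℕ) (R δ : ℝ) : (annulus d R δ).Finite := by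
  obtain ⟨M, hM⟩ := exists_nat_ge (R + δ / 2)
  refine (Set.Finite.pi' (fun _ : Fin d => Set.finite_Icc (-(M : ℤ)) (M : ℤ))).subset ?_
  intro k hk i
  have h1 : latticeNorm k ≤ M := by
    have := (abs_le.mp (show |latticeNorm k - R| ≤ δ / 2 from hk)).2
    linarith
  have h2 : |(k i : ℝ)| ≤ latticeNorm k := by
    rw [← Real.sqrt_sq_eq_abs]
    exact Real.sqrt_le_sqrt
      (Finset.single_le_sum (f := fun j => (k j : ℝ) ^ 2) (fun j _ => sq_nonneg _)
        (Finset.mem_univ i))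
  have h3 := abs_le.mp (h2.trans h1)
  exact ⟨by exact_mod_cast h3.1, by exact_mod_cast h3.2⟩

/-- The spectral projector onto the frequencies in the annulus of radius `R` and width `δ`:
`x ↦ ∑ k, 𝓕(f)(k) e(k · x)`, the sum being over the integer vectors `k` in the annulus.
Here `UnitAddTorus (Fin d)` is `ℝ^d / ℤ^d` with its Haar probability measure. -/
def specProj {d : ℕ} (R δ : ℝ) (f : UnitAddTorus (Fin d) → ℂ) : UnitAddTorus (Fin d) → ℂ :=
  fun x => ∑ k ∈ (annulus_finite d R δ).toFinset,
    UnitAddTorus.mFourierCoeff f k * UnitAddTorus.mFourier k x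

end

/-!
Write `F = P f` and let `g` be the phase of `F` on the level set `{|F| > α}`. By duality and
Cauchy–Schwarz, the measure of the level set is controlled by `∑ |ĝ(k)|²` over the annulus. There
`|k|²` takes only `O(N δ)` integer values, and extracting each of them by integration in `t` bounds
`L ^ d` times this sum by `N δ` times the `L¹` norm in `t` of `∑ w(k) |ĝ(k)|² e(t |k|²)`, where `w`
is a product of tents of width `L ∼ N`.

For fixed `t` this sum is bounded by `‖g‖₁²` times the supremum of the kernel
`∑ w(k) e(t |k|² + k · x)` (the dispersive bound), and by `L ^ d ‖g‖₂²` (Bessel). The kernel factors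
into `d` one-dimensional quadratic Weyl sums, whose sup norm, by Weyl differencing, is of size
`L² q^{-1/2} (1 + L² |2t - a/q|)^{-1/2}` near `2t = a/q`; its moments of order `s > 4` are therefore
`O(L ^ (2s - 2))`. Interpolating the two bounds so that the kernel enters to a power `θ` with
`4 < d θ ≤ d` yields a weak-type inequality for `F` at every exponent above `2d / (d - 4)`. The
endpoint `θ = 1` is a sup bound, since a nonempty level set is open and so has positive measure, and
the two together give the `L^p` estimate.
-/

noncomputable section

open Finset
open scoped FourierTransform fwdDiff ComplexConjugate

section SummationByParts

theorem summable_fwdDiff {h : ℤ → ℂ} (hh : Summable h) : Summable (Δ_[1] h) :=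
  (hh.comp_injective (add_left_injective 1)).sub hh

theorem summable_mul_zpow {h : ℤ → ℂ} (hh : Summable h) {z : ℂ} (hz : ‖z‖ = 1) :
    Summable fun l ↦ h l * z ^ l :=
  .of_norm <| by simpa [hz] using hh.norm

theorem tsum_fwdDiff_mul_zpow {h : ℤ → ℂ} (hh : Summable h) {z : ℂ} (hz : ‖z‖ = 1) :
    ∑' l, Δ_[1] h l * z ^ l = (z⁻¹ - 1) * ∑' l, h l * z ^ l := by
  have hz₀ : z ≠ 0 := by rintro rfl; simp at hz
  have hshift (l : ℤ) : h (l + 1) * z ^ l = z⁻¹ * (h (l + 1) * z ^ (l + 1)) := by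
    rw [zpow_add_one₀ hz₀]
    field_simp
  have hsum := summable_mul_zpow hh hz
  have hsum' : Summable fun l ↦ h (l + 1) * z ^ l := by
    simp only [hshift]
    exact (hsum.comp_injective (add_left_injective 1)).mul_left z⁻¹
  simp only [fwdDiff, sub_mul, one_mul]
  rw [hsum'.tsum_sub hsum, tsum_congr hshift, tsum_mul_left,
    ← (Equiv.addRight (1 : ℤ)).tsum_eq fun l ↦ h l * z ^ l]
  rfl

theorem norm_sub_one_sq_mul_norm_tsum_le {h : ℤ → ℂ} (hh : Summable h) {z : ℂ} (hz : ‖z‖ = 1) :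
    ‖z - 1‖ ^ 2 * ‖∑' l, h l * z ^ l‖ ≤ ∑' l, ‖Δ_[1] (Δ_[1] h) l‖ := by
  have hz₀ : z ≠ 0 := by rintro rfl; simp at hz
  have hinv : ‖z⁻¹ - 1‖ = ‖z - 1‖ := by
    rw [show z⁻¹ - 1 = z⁻¹ * (1 - z) by field_simp, norm_mul, norm_inv, hz, inv_one, one_mul,
      norm_sub_rev]
  have hΔ := summable_fwdDiff (summable_fwdDiff hh)
  calc ‖z - 1‖ ^ 2 * ‖∑' l, h l * z ^ l‖
      = ‖∑' l, Δ_[1] (Δ_[1] h) l * z ^ l‖ := by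
        rw [tsum_fwdDiff_mul_zpow (summable_fwdDiff hh) hz, tsum_fwdDiff_mul_zpow hh hz,
          ← mul_assoc, norm_mul, norm_mul, hinv, sq]
    _ ≤ ∑' l, ‖Δ_[1] (Δ_[1] h) l * z ^ l‖ :=
        norm_tsum_le_tsum_norm (summable_mul_zpow hΔ hz).norm
    _ = ∑' l, ‖Δ_[1] (Δ_[1] h) l‖ := by simp [hz]

theorem fwdDiff_fwdDiff_mul (f g : ℤ → ℂ) (l : ℤ) :
    Δ_[1] (Δ_[1] (f * g)) l = f (l + 1) * Δ_[1] (Δ_[1] g) l + g (l + 1) * Δ_[1] (Δ_[1] f) l +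
      Δ_[1] f l * Δ_[1] g l + Δ_[1] f (l + 1) * Δ_[1] g (l + 1) := by
  simp only [fwdDiff, Pi.mul_apply]
  ring

theorem tsum_norm_fwdDiff_fwdDiff_mul_le {f g : ℤ → ℂ} {M : ℝ} (hf : Summable f) (hg : Summable g)
    (hfM : ∀ l, ‖f l‖ ≤ M) (hgM : ∀ l, ‖g l‖ ≤ M) (hΔg : ∀ l, ‖Δ_[1] g l‖ ≤ 1) :
    ∑' l, ‖Δ_[1] (Δ_[1] (f * g)) l‖ ≤
      M * ∑' l, ‖Δ_[1] (Δ_[1] g) l‖ + M * ∑' l, ‖Δ_[1] (Δ_[1] f) l‖ + 2 * ∑' l, ‖Δ_[1] f l‖ := by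
  have hΔf := (summable_fwdDiff hf).norm
  have hΔΔf := (summable_fwdDiff (summable_fwdDiff hf)).norm
  have hΔΔg := (summable_fwdDiff (summable_fwdDiff hg)).norm
  have hΔf' : Summable fun l ↦ ‖Δ_[1] f (l + 1)‖ := hΔf.comp_injective (add_left_injective 1)
  have hshift : ∑' l, ‖Δ_[1] f (l + 1)‖ = ∑' l, ‖Δ_[1] f l‖ :=
    (Equiv.addRight (1 : ℤ)).tsum_eq fun l ↦ ‖Δ_[1] f l‖
  have hbound (l : ℤ) : ‖Δ_[1] (Δ_[1] (f * g)) l‖ ≤ M * ‖Δ_[1] (Δ_[1] g) l‖ +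
      M * ‖Δ_[1] (Δ_[1] f) l‖ + ‖Δ_[1] f l‖ + ‖Δ_[1] f (l + 1)‖ := by
    rw [fwdDiff_fwdDiff_mul]
    refine norm_add₄_le.trans ?_
    simp only [norm_mul]
    gcongr
    · exact hfM _
    · exact hgM _
    · exact mul_le_of_le_one_right (norm_nonneg _) (hΔg _)
    · exact mul_le_of_le_one_right (norm_nonneg _) (hΔg _)
  have hmaj := (((hΔΔg.mul_left M).add (hΔΔf.mul_left M)).add hΔf).add hΔf'
  have hsummable := hmaj.of_nonneg_of_le (fun _ ↦ norm_nonneg _) hbound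
  refine (hsummable.tsum_le_tsum hbound hmaj).trans_eq ?_
  rw [(((hΔΔg.mul_left M).add (hΔΔf.mul_left M)).add hΔf).tsum_add hΔf',
    ((hΔΔg.mul_left M).add (hΔΔf.mul_left M)).tsum_add hΔf,
    (hΔΔg.mul_left M).tsum_add (hΔΔf.mul_left M), tsum_mul_left, tsum_mul_left, hshift]
  ring

end SummationByParts

section Tent

/-- The unnormalized Fejér weight `max 0 (L - |k|)` on the integers. -/
def tent (L : ℕ) (k : ℤ) : ℤ := max 0 (L - k.natAbs)

theorem tent_nonneg (L : ℕ) (k : ℤ) : 0 ≤ (tent L k : ℝ) := by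
  exact_mod_cast le_max_left _ _

theorem tent_eq_zero {L : ℕ} {k : ℤ} (hk : k ∉ Ioo (-L : ℤ) L) : tent L k = 0 := by
  rw [mem_Ioo] at hk
  unfold tent
  omega

theorem norm_tent_le (L : ℕ) (k : ℤ) : ‖(tent L k : ℂ)‖ ≤ L := by
  have h : |tent L k| ≤ L := by unfold tent; grind
  rw [Complex.norm_intCast]
  exact_mod_cast h

theorem summable_tent (L : ℕ) : Summable fun k ↦ (tent L k : ℂ) :=
  summable_of_ne_finset_zero (s := Ioo (-L : ℤ) L) fun k hk ↦ by simp [tent_eq_zero hk]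

theorem norm_fwdDiff_tent_le (L : ℕ) (k : ℤ) : ‖Δ_[1] (fun k ↦ (tent L k : ℂ)) k‖ ≤ 1 := by
  have h : |tent L (k + 1) - tent L k| ≤ 1 := by unfold tent; grind
  rw [fwdDiff, ← Int.cast_sub, Complex.norm_intCast]
  exact_mod_cast h

theorem tsum_norm_fwdDiff_tent_le (L : ℕ) :
    ∑' k, ‖Δ_[1] (fun k ↦ (tent L k : ℂ)) k‖ ≤ 2 * L := by
  rw [tsum_eq_sum (s := Ico (-L : ℤ) L)]
  · refine (sum_le_card_nsmul _ _ 1 fun k _ ↦ norm_fwdDiff_tent_le L k).trans_eq ?_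
    rw [Int.card_Ico, sub_neg_eq_add, ← two_mul, nsmul_one]
    norm_cast
  · intro k hk
    rw [mem_Ico] at hk
    simp [fwdDiff, tent_eq_zero (L := L) (k := k) (by grind),
      tent_eq_zero (L := L) (k := k + 1) (by grind)]

theorem tsum_norm_fwdDiff_fwdDiff_tent_le (L : ℕ) :
    ∑' k, ‖Δ_[1] (Δ_[1] fun k ↦ (tent L k : ℂ)) k‖ ≤ 6 := by
  have hcast (k : ℤ) : Δ_[1] (Δ_[1] fun k ↦ (tent L k : ℂ)) k =
      (tent L (k + 2) - 2 * tent L (k + 1) + tent L k : ℤ) := by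
    simp only [fwdDiff, add_assoc, one_add_one_eq_two]
    push_cast
    ring
  simp only [hcast, Complex.norm_intCast]
  rw [tsum_eq_sum (s := {-(L : ℤ) - 1, -1, (L : ℤ) - 1})]
  · have hle (k : ℤ) : |((tent L (k + 2) - 2 * tent L (k + 1) + tent L k : ℤ) : ℝ)| ≤ 2 := by
      have h : |tent L (k + 2) - 2 * tent L (k + 1) + tent L k| ≤ 2 := by unfold tent; grind
      exact_mod_cast h
    refine (sum_le_card_nsmul _ _ 2 fun k _ ↦ hle k).trans ?_
    have hcard : (#{-(L : ℤ) - 1, -1, (L : ℤ) - 1} : ℝ) ≤ 3 := by exact_mod_cast card_le_three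
    rw [nsmul_eq_mul]
    linarith
  · intro k hk
    have h : tent L (k + 2) - 2 * tent L (k + 1) + tent L k = 0 := by
      simp only [mem_insert, mem_singleton, not_or] at hk
      unfold tent
      omega
    simp [h]

theorem four_mul_abs_sub_round_le_norm_fourierChar_sub_one (y : ℝ) :
    4 * |y - round y| ≤ ‖(𝐞 y : ℂ) - 1‖ := by
  set r := y - round y
  have hy : (𝐞 y : ℂ) = Complex.exp (Complex.I * (2 * Real.pi * r : ℝ)) := by
    rw [Real.fourierChar_apply, Complex.exp_eq_exp_iff_exists_int]
    exact ⟨round y, by simp only [r]; push_cast; ring⟩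
  have hr : Real.pi * |r| ≤ Real.pi / 2 := by
    have := abs_sub_round y
    nlinarith [Real.pi_pos]
  have hsin : 2 * |r| ≤ |Real.sin (Real.pi * r)| := by
    have := Real.mul_abs_le_abs_sin (x := Real.pi * r) (by rwa [abs_mul, abs_of_pos Real.pi_pos])
    rwa [abs_mul, abs_of_pos Real.pi_pos, ← mul_assoc, div_mul_cancel₀ _ Real.pi_ne_zero] at this
  rw [hy, Complex.norm_exp_I_mul_ofReal_sub_one, norm_mul, Real.norm_ofNat, Real.norm_eq_abs,
    mul_assoc, mul_div_cancel_left₀ _ two_ne_zero]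
  linarith

theorem summable_tent_mul_tent (L : ℕ) (m : ℤ) :
    Summable fun l ↦ (tent L l * tent L (l + m) : ℂ) :=
  summable_of_ne_finset_zero (s := Ioo (-L : ℤ) L) fun l hl ↦ by
    rw [tent_eq_zero hl, Int.cast_zero, zero_mul]

theorem norm_tsum_tent_mul_tent_mul_zpow_le_two_mul (L : ℕ) (m : ℤ) {z : ℂ} (hz : ‖z‖ = 1) :
    ‖∑' l, (tent L l * tent L (l + m) : ℂ) * z ^ l‖ ≤ 2 * L ^ 3 := by
  have hterm (l : ℤ) : ‖(tent L l * tent L (l + m) : ℂ) * z ^ l‖ ≤ (L : ℝ) ^ 2 := by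
    rw [norm_mul, norm_zpow, hz, one_zpow, mul_one, norm_mul, sq]
    exact mul_le_mul (norm_tent_le L _) (norm_tent_le L _) (norm_nonneg _) (Nat.cast_nonneg _)
  have hcard : (#(Ioo (-L : ℤ) L) : ℝ) ≤ 2 * L := by
    have : #(Ioo (-L : ℤ) L) ≤ 2 * L := by rw [Int.card_Ioo]; omega
    exact_mod_cast this
  have hsupp : ∀ l ∉ Ioo (-L : ℤ) L, (tent L l * tent L (l + m) : ℂ) * z ^ l = 0 := fun l hl ↦ by
    rw [tent_eq_zero hl, Int.cast_zero, zero_mul, zero_mul]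
  rw [tsum_eq_sum hsupp]
  refine (norm_sum_le_of_le _ fun l _ ↦ hterm l).trans ?_
  rw [sum_const, nsmul_eq_mul]
  nlinarith [sq_nonneg (L : ℝ)]

theorem norm_sub_one_sq_mul_norm_tsum_tent_mul_tent_le (L : ℕ) (m : ℤ) {z : ℂ} (hz : ‖z‖ = 1) :
    ‖z - 1‖ ^ 2 * ‖∑' l, (tent L l * tent L (l + m) : ℂ) * z ^ l‖ ≤ 16 * L := by
  set f : ℤ → ℂ := fun l ↦ tent L l
  set g : ℤ → ℂ := fun l ↦ tent L (l + m)
  have hΔg : Δ_[1] g = fun l ↦ Δ_[1] f (l + m) := funext fun l ↦ fwdDiff_comp_add 1 f m l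
  have hΔΔg : Δ_[1] (Δ_[1] g) = fun l ↦ Δ_[1] (Δ_[1] f) (l + m) := by
    rw [hΔg]
    exact funext fun l ↦ fwdDiff_comp_add 1 (Δ_[1] f) m l
  have hΔΔg_sum : ∑' l, ‖Δ_[1] (Δ_[1] g) l‖ = ∑' l, ‖Δ_[1] (Δ_[1] f) l‖ := by
    rw [hΔΔg]
    exact (Equiv.addRight m).tsum_eq fun l ↦ ‖Δ_[1] (Δ_[1] f) l‖
  have hg : Summable g := (summable_tent L).comp_injective (add_left_injective m)
  have hleibniz := tsum_norm_fwdDiff_fwdDiff_mul_le (summable_tent L) hg (norm_tent_le L)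
    (fun l ↦ norm_tent_le L (l + m)) (fun l ↦ by rw [hΔg]; exact norm_fwdDiff_tent_le L _)
  have h₁ := tsum_norm_fwdDiff_tent_le L
  have h₂ := tsum_norm_fwdDiff_fwdDiff_tent_le L
  refine (norm_sub_one_sq_mul_norm_tsum_le (summable_tent_mul_tent L m) hz).trans
    (hleibniz.trans ?_)
  rw [hΔΔg_sum]
  nlinarith [(Nat.cast_nonneg L : (0 : ℝ) ≤ L)]

theorem norm_tsum_tent_mul_tent_mul_zpow_le (L : ℕ) (m : ℤ) (y : ℝ) :
    ‖∑' l, (tent L l * tent L (l + m) : ℂ) * (𝐞 y : ℂ) ^ l‖ ≤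
      3 * L ^ 3 / (1 + (L * (y - round y)) ^ 2) := by
  have hz : ‖(𝐞 y : ℂ)‖ = 1 := Circle.norm_coe _
  have hround : 16 * (y - round y) ^ 2 ≤ ‖(𝐞 y : ℂ) - 1‖ ^ 2 := by
    have := four_mul_abs_sub_round_le_norm_fourierChar_sub_one y
    rw [← sq_abs]
    nlinarith [abs_nonneg (y - round y)]
  have htrivial := norm_tsum_tent_mul_tent_mul_zpow_le_two_mul L m hz
  have hdecay := mul_le_mul_of_nonneg_left ((mul_le_mul_of_nonneg_right hround
    (norm_nonneg _)).trans (norm_sub_one_sq_mul_norm_tsum_tent_mul_tent_le L m hz))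
      (sq_nonneg (L : ℝ))
  rw [le_div_iff₀ (by positivity)]
  linear_combination htrivial + hdecay / 16

end Tent

section WeylSum

theorem norm_sum_sq_le_sum_norm_correlation {L : ℕ} {φ : ℤ → ℂ}
    (hφ : ∀ k ∉ Icc (-L : ℤ) L, φ k = 0) :
    ‖∑ k ∈ Icc (-L : ℤ) L, φ k‖ ^ 2 ≤
      ∑ m ∈ Icc (-(2 * L) : ℤ) (2 * L), ‖∑ l ∈ Icc (-L : ℤ) L, φ (l + m) * conj (φ l)‖ := by
  have hshift : ∀ l ∈ Icc (-L : ℤ) L,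
      ∑ k ∈ Icc (-L : ℤ) L, φ k = ∑ m ∈ Icc (-(2 * L) : ℤ) (2 * L), φ (l + m) := by
    intro l hl
    rw [mem_Icc] at hl
    have hmap := sum_map (Icc (-(2 * L) : ℤ) (2 * L)) (addLeftEmbedding l) φ
    rw [map_add_left_Icc] at hmap
    refine Eq.trans ?_ hmap
    exact sum_subset (Icc_subset_Icc (by omega) (by omega)) fun k _ ↦ hφ k
  calc ‖∑ k ∈ Icc (-L : ℤ) L, φ k‖ ^ 2
      = ‖∑ l ∈ Icc (-L : ℤ) L, (∑ k ∈ Icc (-L : ℤ) L, φ k) * conj (φ l)‖ := by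
        rw [← mul_sum, ← map_sum, norm_mul, RCLike.norm_conj, sq]
    _ = ‖∑ m ∈ Icc (-(2 * L) : ℤ) (2 * L), ∑ l ∈ Icc (-L : ℤ) L, φ (l + m) * conj (φ l)‖ := by
        rw [sum_congr rfl fun l hl ↦ by rw [hshift l hl, sum_mul], sum_comm]
    _ ≤ _ := norm_sum_le _ _

/-- The quadratic Weyl sum `x ↦ ∑ k, tent L k * e(t k² + k x)` on the circle. -/
def weylSum (L : ℕ) (t : ℝ) : C(UnitAddCircle, ℂ) :=
  ∑ k ∈ Icc (-L : ℤ) L, ((tent L k : ℂ) * 𝐞 (t * k ^ 2)) • fourier k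

theorem weylSum_apply (L : ℕ) (t : ℝ) (x : UnitAddCircle) :
    weylSum L t x = ∑ k ∈ Icc (-L : ℤ) L, (tent L k : ℂ) * 𝐞 (t * k ^ 2) * fourier k x := by
  simp only [weylSum, ContinuousMap.coe_sum, ContinuousMap.coe_smul, Finset.sum_apply,
    Pi.smul_apply, smul_eq_mul]

theorem fourierChar_add_sq_mul_conj (t : ℝ) (l m : ℤ) :
    (𝐞 (t * (l + m : ℤ) ^ 2) : ℂ) * conj (𝐞 (t * l ^ 2) : ℂ) =
      𝐞 (t * m ^ 2) * (𝐞 (m * (2 * t)) : ℂ) ^ l := by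
  rw [← Circle.coe_inv_eq_conj, ← AddChar.map_neg_eq_inv, ← Circle.coe_zpow,
    ← AddChar.map_zsmul_eq_zpow, ← Circle.coe_mul, ← Circle.coe_mul, ← AddChar.map_add_eq_mul,
    ← AddChar.map_add_eq_mul, zsmul_eq_mul]
  congr 2
  push_cast
  ring

theorem fourier_add_mul_conj (l m : ℤ) (x : UnitAddCircle) :
    fourier (l + m) x * conj (fourier l x) = fourier m x := by
  rw [← fourier_neg, ← fourier_add, add_neg_cancel_comm]

theorem norm_weylSum_sq_le (L : ℕ) (t : ℝ) :
    ‖weylSum L t‖ ^ 2 ≤ ∑ m ∈ Icc (-(2 * L) : ℤ) (2 * L),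
      3 * L ^ 3 / (1 + (L * (m * (2 * t) - round (m * (2 * t)))) ^ 2) := by
  rw [← Real.le_sqrt (norm_nonneg _) (by positivity), ContinuousMap.norm_le _ (Real.sqrt_nonneg _)]
  refine fun x ↦ Real.le_sqrt_of_sq_le ?_
  set φ : ℤ → ℂ := fun k ↦ tent L k * 𝐞 (t * k ^ 2) * fourier k x
  have hφ : ∀ k ∉ Icc (-L : ℤ) L, φ k = 0 := fun k hk ↦ by
    simp only [φ, tent_eq_zero fun h ↦ hk (Ioo_subset_Icc_self h), Int.cast_zero, zero_mul]
  rw [weylSum_apply]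
  refine (norm_sum_sq_le_sum_norm_correlation hφ).trans (sum_le_sum fun m _ ↦ ?_)
  have hcorr (l : ℤ) : φ (l + m) * conj (φ l) = 𝐞 (t * m ^ 2) * fourier m x *
      ((tent L l * tent L (l + m) : ℂ) * (𝐞 (m * (2 * t)) : ℂ) ^ l) := by
    simp only [φ, map_mul, map_intCast]
    linear_combination (tent L l : ℂ) * tent L (l + m) *
      (𝐞 (t * (l + m : ℤ) ^ 2) * conj (𝐞 (t * l ^ 2) : ℂ) * fourier_add_mul_conj l m x +
        fourier m x * fourierChar_add_sq_mul_conj t l m)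
  have hunit : ‖fourier m x‖ = 1 := by rw [fourier_apply, Circle.norm_coe]
  rw [sum_congr rfl fun l _ ↦ hcorr l, ← mul_sum, norm_mul, norm_mul, Circle.norm_coe, hunit,
    one_mul, one_mul, ← tsum_eq_sum (L := .unconditional ℤ)]
  · exact norm_tsum_tent_mul_tent_mul_zpow_le L m _
  · intro l hl
    simp only [tent_eq_zero fun h ↦ hl (Ioo_subset_Icc_self h), Int.cast_zero, zero_mul]

end WeylSum

section NearIntegers

variable {L q : ℕ} {a : ℤ} {u : ℝ}

/-- The integers `m` with `|m| ≤ 4L` for which `m u` is within `1 / L` of an integer. -/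
def nearIntegers (L : ℕ) (u : ℝ) : Finset ℤ :=
  {m ∈ Icc (-(4 * L) : ℤ) (4 * L) | L * |m * u - round (m * u)| ≤ 1}

theorem abs_le_of_mem_nearIntegers {m : ℤ} (hm : m ∈ nearIntegers L u) : |(m : ℝ)| ≤ 4 * L := by
  obtain ⟨h₁, h₂⟩ := mem_Icc.1 (mem_filter.1 hm).1
  exact abs_le.2 ⟨by exact_mod_cast h₁, by exact_mod_cast h₂⟩

theorem abs_sub_round_le_of_mem_nearIntegers {m : ℤ} (hm : m ∈ nearIntegers L u) :
    L * |m * u - round (m * u)| ≤ 1 :=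
  (mem_filter.1 hm).2

/-- The quality of `a / q` as an approximation to `u` at scale `L`; up to constants, its reciprocal
is the cardinality of `nearIntegers L u`. -/
def approxScale (L q : ℕ) (a : ℤ) (u : ℝ) : ℝ :=
  max (q / L) (L * |q * u - a|)

theorem abs_mul_sub_round_mul_le {m : ℤ} (hqL : q ≤ L) (hu : L * |q * u - a| ≤ 1)
    (hm : m ∈ nearIntegers L u) : |m * a - round (m * u) * q| ≤ 5 := by
  have hqL' : (q : ℝ) ≤ L := by exact_mod_cast hqL
  have hdet : ((m * a - round (m * u) * q : ℤ) : ℝ) =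
      q * (m * u - round (m * u)) - m * (q * u - a) := by
    push_cast
    ring
  suffices h : |((m * a - round (m * u) * q : ℤ) : ℝ)| ≤ 5 by exact_mod_cast h
  calc |((m * a - round (m * u) * q : ℤ) : ℝ)|
      ≤ q * |m * u - round (m * u)| + |(m : ℝ)| * |q * u - a| := by
        rw [hdet]
        refine (abs_sub _ _).trans_eq ?_
        rw [abs_mul, abs_mul, Nat.abs_cast]
    _ ≤ L * |m * u - round (m * u)| + 4 * L * |q * u - a| := by
        gcongr
        exact abs_le_of_mem_nearIntegers hm
    _ ≤ 5 := by linarith [abs_sub_round_le_of_mem_nearIntegers hm]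

theorem abs_mul_approxScale_le {m m₀ r : ℤ} (hL : 0 < L) (hm : m ∈ nearIntegers L u)
    (hm₀ : m₀ ∈ nearIntegers L u) (hmr : m - m₀ = r * q)
    (hround : round (m * u) - round (m₀ * u) = r * a) : |(r : ℝ)| * approxScale L q a u ≤ 8 := by
  have hL' : (0 : ℝ) < L := by exact_mod_cast hL
  have hmr' : (m - m₀ : ℝ) = r * q := by exact_mod_cast hmr
  have hround' : (round (m * u) - round (m₀ * u) : ℝ) = r * a := by exact_mod_cast hround
  rw [approxScale, mul_max_of_nonneg _ _ (abs_nonneg _)]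
  refine max_le ?_ ?_
  · rw [← mul_div_assoc, div_le_iff₀ hL']
    calc |(r : ℝ)| * q = |(m - m₀ : ℝ)| := by rw [hmr', abs_mul, Nat.abs_cast]
      _ ≤ |(m : ℝ)| + |(m₀ : ℝ)| := abs_sub _ _
      _ ≤ 8 * L := by
        linarith [abs_le_of_mem_nearIntegers hm, abs_le_of_mem_nearIntegers hm₀]
  · calc |(r : ℝ)| * (L * |q * u - a|)
        = L * |(m * u - round (m * u)) - (m₀ * u - round (m₀ * u))| := by
          rw [mul_left_comm, ← abs_mul]
          congr 2
          linear_combination -u * hmr' + hround'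
      _ ≤ L * (|m * u - round (m * u)| + |m₀ * u - round (m₀ * u)|) := by
        gcongr
        exact abs_sub _ _
      _ ≤ 8 := by
        linarith [abs_sub_round_le_of_mem_nearIntegers hm, abs_sub_round_le_of_mem_nearIntegers hm₀]

theorem exists_eq_mul_of_mul_sub_mul_eq {m m₀ n n₀ : ℤ} (hq : 0 < q) (hcop : IsCoprime a q)
    (h : m * a - n * q = m₀ * a - n₀ * q) : ∃ r, m - m₀ = r * q ∧ n - n₀ = r * a := by
  have h' : (m - m₀) * a = (n - n₀) * q := by linear_combination h
  obtain ⟨r, hr⟩ : (q : ℤ) ∣ m - m₀ :=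
    hcop.symm.dvd_of_dvd_mul_right ⟨n - n₀, by rw [h', mul_comm]⟩
  refine ⟨r, by rw [hr, mul_comm], ?_⟩
  apply mul_right_cancel₀ (b := (q : ℤ)) (by positivity)
  rw [← h', hr]
  ring

theorem approxScale_pos (hL : 0 < L) (hq : 0 < q) : 0 < approxScale L q a u :=
  lt_max_of_lt_left (by positivity)

theorem card_filter_nearIntegers_le (hL : 0 < L) (hq : 0 < q) (hcop : IsCoprime a q) (b : ℤ) :
    #((nearIntegers L u).filter fun m : ℤ ↦ m * a - round (m * u) * q = b) ≤
      2 * ⌊8 / approxScale L q a u⌋₊ + 1 := by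
  set K := ⌊8 / approxScale L q a u⌋₊ with hK
  set F := (nearIntegers L u).filter fun m : ℤ ↦ m * a - round (m * u) * q = b
  obtain h | ⟨m₀, hm₀⟩ := F.eq_empty_or_nonempty
  · simp [h]
  rw [mem_filter] at hm₀
  have hsub : F ⊆ (Icc (-K : ℤ) K).image fun r ↦ m₀ + r * q := by
    intro m hm
    rw [mem_filter] at hm
    obtain ⟨r, hmr, hround⟩ := exists_eq_mul_of_mul_sub_mul_eq hq hcop (hm.2.trans hm₀.2.symm)
    have hr : r.natAbs ≤ K := by
      rw [hK, Nat.le_floor_iff (by have := approxScale_pos (a := a) (u := u) hL hq; positivity),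
        le_div_iff₀ (approxScale_pos hL hq), Nat.cast_natAbs, Int.cast_abs]
      exact abs_mul_approxScale_le hL hm.1 hm₀.1 hmr hround
    exact mem_image.2 ⟨r, by rw [mem_Icc]; omega, by rw [← hmr]; ring⟩
  refine (card_le_card hsub).trans (card_image_le.trans_eq ?_)
  rw [Int.card_Icc]
  omega

theorem card_nearIntegers_le (hL : 0 < L) (hq : 0 < q) (hqL : q ≤ L) (hcop : IsCoprime a q)
    (hu : L * |q * u - a| ≤ 1) : (#(nearIntegers L u) : ℝ) ≤ 187 / approxScale L q a u := by
  have hL' : (0 : ℝ) < L := by exact_mod_cast hL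
  have hscale : 0 < approxScale L q a u := approxScale_pos hL hq
  have hscale_le : approxScale L q a u ≤ 1 :=
    max_le ((div_le_one hL').2 (by exact_mod_cast hqL)) hu
  -- Each of the 11 possible values of `m * a - round (m * u) * q` determines `m` modulo `q`.
  have hmaps : ∀ m ∈ nearIntegers L u, m * a - round (m * u) * q ∈ Icc (-5 : ℤ) 5 := fun m hm ↦
    mem_Icc.2 (abs_le.1 (abs_mul_sub_round_mul_le hqL hu hm))
  have hcard := card_le_mul_card_image_of_maps_to hmaps _
    fun b _ ↦ card_filter_nearIntegers_le (u := u) hL hq hcop b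
  have hfloor := Nat.floor_le (div_nonneg (by norm_num : (0 : ℝ) ≤ 8) hscale.le)
  calc (#(nearIntegers L u) : ℝ) ≤ (2 * ⌊8 / approxScale L q a u⌋₊ + 1) * 11 := by
        exact_mod_cast hcard
    _ ≤ (2 * (8 / approxScale L q a u) + 1 / approxScale L q a u) * 11 := by
        gcongr
        exact (one_le_div hscale).2 hscale_le
    _ = 187 / approxScale L q a u := by ring

theorem summable_inv_one_add_sq : Summable fun j : ℤ ↦ (1 + (j : ℝ) ^ 2)⁻¹ := by
  refine (Real.summable_one_div_int_pow.2 one_lt_two).of_norm_bounded_eventually ?_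
  filter_upwards [(Set.finite_singleton (0 : ℤ)).compl_mem_cofinite] with j hj
  have hj' : (j : ℝ) ≠ 0 := by exact_mod_cast hj
  rw [Real.norm_of_nonneg (by positivity), ← one_div]
  exact one_div_le_one_div_of_le (by positivity) (by linarith)

theorem inv_one_add_sq_le_floor (x : ℝ) : (1 + x ^ 2)⁻¹ ≤ 3 * (1 + (⌊x⌋ : ℝ) ^ 2)⁻¹ := by
  have h₁ := Int.floor_le x
  have h₂ := Int.lt_floor_add_one x
  rw [← div_eq_mul_inv, ← one_div, div_le_div_iff₀ (by positivity) (by positivity)]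
  nlinarith [sq_nonneg x, sq_nonneg (2 * x - ⌊x⌋)]

theorem card_filter_floor_mul_sub_round_le (j : ℤ) :
    #((Icc (-(2 * L) : ℤ) (2 * L)).filter fun m : ℤ ↦ ⌊L * (m * u - round (m * u))⌋ = j) ≤
      #(nearIntegers L u) := by
  set B := (Icc (-(2 * L) : ℤ) (2 * L)).filter fun m : ℤ ↦ ⌊L * (m * u - round (m * u))⌋ = j
    with hB
  obtain h | ⟨m₀, hm₀⟩ := B.eq_empty_or_nonempty
  · simp [h]
  refine card_le_card_of_injOn (· - m₀) (fun m hm ↦ ?_) (sub_left_injective.injOn)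
  simp only [hB, coe_filter, mem_filter, mem_Icc, Set.mem_ofPred_eq] at hm hm₀
  refine mem_filter.2 ⟨by simp only [mem_Icc]; omega, ?_⟩
  calc (L : ℝ) * |(m - m₀ : ℤ) * u - round (((m - m₀ : ℤ) : ℝ) * u)|
      ≤ L * |(m - m₀ : ℤ) * u - (round (m * u) - round (m₀ * u) : ℤ)| :=
        mul_le_mul_of_nonneg_left (round_le _ _) L.cast_nonneg
    _ = |L * (m * u - round (m * u)) - L * (m₀ * u - round (m₀ * u))| := by
        rw [← mul_sub, abs_mul, Nat.abs_cast]
        push_cast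
        ring_nf
    _ ≤ 1 := (Int.abs_sub_lt_one_of_floor_eq_floor (hm.2.trans hm₀.2.symm)).le

theorem sum_inv_one_add_sq_sub_round_le :
    ∑ m ∈ Icc (-(2 * L) : ℤ) (2 * L), (1 + (L * (m * u - round (m * u))) ^ 2 : ℝ)⁻¹ ≤
      3 * (#(nearIntegers L u) : ℝ) * ∑' j : ℤ, (1 + (j : ℝ) ^ 2)⁻¹ := by
  set I := Icc (-(2 * L) : ℤ) (2 * L)
  set x : ℤ → ℝ := fun m ↦ L * (m * u - round (m * u))
  calc ∑ m ∈ I, (1 + x m ^ 2)⁻¹ ≤ ∑ m ∈ I, 3 * (1 + (⌊x m⌋ : ℝ) ^ 2)⁻¹ :=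
        sum_le_sum fun m _ ↦ inv_one_add_sq_le_floor (x m)
    _ = ∑ j ∈ I.image (⌊x ·⌋), #{m ∈ I | ⌊x m⌋ = j} • (3 * (1 + (j : ℝ) ^ 2)⁻¹) :=
        sum_comp (fun j : ℤ ↦ 3 * (1 + (j : ℝ) ^ 2)⁻¹) _
    _ ≤ ∑ j ∈ I.image (⌊x ·⌋), 3 * (#(nearIntegers L u) : ℝ) * (1 + (j : ℝ) ^ 2)⁻¹ := by
        refine sum_le_sum fun j _ ↦ ?_
        rw [nsmul_eq_mul, mul_left_comm, mul_assoc 3]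
        gcongr 3 * (?_ * _)
        exact_mod_cast card_filter_floor_mul_sub_round_le j
    _ ≤ 3 * (#(nearIntegers L u) : ℝ) * ∑' j : ℤ, (1 + (j : ℝ) ^ 2)⁻¹ := by
        rw [← mul_sum]
        gcongr
        exact summable_inv_one_add_sq.sum_le_tsum _ fun _ _ ↦ by positivity

end NearIntegers

section WeylMoment

variable {L q : ℕ} {a : ℤ} {s t u : ℝ}

theorem mul_approxScale (hL : 0 < L) (hq : 0 < q) :
    L * approxScale L q a u = q * max 1 (L ^ 2 * |u - a / q|) := by
  have hL' : (0 : ℝ) < L := by exact_mod_cast hL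
  have hq' : (0 : ℝ) < q := by exact_mod_cast hq
  have habs : |q * u - a| = q * |u - a / q| := by
    rw [← Nat.abs_cast q, ← abs_mul, Nat.abs_cast, mul_sub, mul_div_cancel₀ _ hq'.ne']
  rw [approxScale, habs, mul_max_of_nonneg _ _ hL'.le, mul_max_of_nonneg _ _ hq'.le,
    mul_div_cancel₀ _ hL'.ne', mul_one]
  congr 1
  ring

theorem norm_weylSum_sq_mul_approxScale_le (hL : 0 < L) (hq : 0 < q) (hqL : q ≤ L)
    (hcop : IsCoprime a q) (hu : L * |q * (2 * t) - a| ≤ 1) :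
    ‖weylSum L t‖ ^ 2 * approxScale L q a (2 * t) ≤
      1683 * (∑' j : ℤ, (1 + (j : ℝ) ^ 2)⁻¹) * L ^ 3 := by
  have hpos := approxScale_pos (a := a) (u := 2 * t) hL hq
  rw [← le_div_iff₀ hpos]
  calc ‖weylSum L t‖ ^ 2
      ≤ 3 * L ^ 3 * ∑ m ∈ Icc (-(2 * L) : ℤ) (2 * L),
          (1 + (L * (m * (2 * t) - round (m * (2 * t)))) ^ 2 : ℝ)⁻¹ := by
        simpa only [mul_sum, div_eq_mul_inv] using norm_weylSum_sq_le L t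
    _ ≤ 3 * L ^ 3 * (3 * (#(nearIntegers L (2 * t)) : ℝ) * ∑' j : ℤ, (1 + (j : ℝ) ^ 2)⁻¹) := by
        gcongr
        exact sum_inv_one_add_sq_sub_round_le
    _ ≤ 3 * L ^ 3 * (3 * (187 / approxScale L q a (2 * t)) * ∑' j : ℤ, (1 + (j : ℝ) ^ 2)⁻¹) := by
        gcongr
        exact card_nearIntegers_le hL hq hqL hcop hu
    _ = _ := by ring

theorem exists_isCoprime_mul_abs_sub_lt_one (hL : 0 < L) (u : ℝ) :
    ∃ q ∈ Icc 1 L, ∃ a : ℤ, IsCoprime a q ∧ L * |q * u - a| < 1 := by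
  obtain ⟨r, hr, hden⟩ := Real.exists_rat_abs_sub_le_and_den_le u hL
  have hq : (0 : ℝ) < r.den := by exact_mod_cast r.pos
  refine ⟨r.den, mem_Icc.2 ⟨r.pos, hden⟩, r.num, ?_, ?_⟩
  · rw [Int.isCoprime_iff_gcd_eq_one, Int.gcd_eq_natAbs, Int.natAbs_natCast]
    exact r.reduced
  · have habs : |r.den * u - r.num| = r.den * |u - r| := by
      rw [Rat.cast_def, ← abs_of_pos hq, ← abs_mul, abs_of_pos hq, mul_sub,
        mul_div_cancel₀ _ hq.ne']
    rw [le_div_iff₀ (by positivity), mul_comm, add_one_mul, add_mul, mul_assoc, ← habs] at hr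
    obtain h | h := (abs_nonneg (r.den * u - r.num)).eq_or_lt
    · rw [← h, mul_zero]
      exact one_pos
    · linarith

theorem mem_Icc_of_abs_mul_sub_lt_one (ht : t ∈ Set.Icc (0 : ℝ) 1)
    (h : |q * (2 * t) - a| < 1) : a ∈ Icc (0 : ℤ) (2 * q) := by
  obtain ⟨h₁, h₂⟩ := abs_lt.1 h
  have hlow : ((-1 : ℤ) : ℝ) < a := by
    push_cast
    linarith [mul_nonneg q.cast_nonneg (mul_nonneg zero_le_two ht.1)]
  have hupp : (a : ℝ) < (2 * q + 1 : ℤ) := by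
    push_cast
    linarith [mul_le_mul_of_nonneg_left ht.2 (q.cast_nonneg (α := ℝ))]
  rw [Int.cast_lt] at hlow hupp
  exact mem_Icc.2 ⟨by omega, by omega⟩

theorem exists_norm_weylSum_sq_le (hL : 0 < L) (ht : t ∈ Set.Icc (0 : ℝ) 1) :
    ∃ q ∈ Icc 1 L, ∃ a ∈ Icc (0 : ℤ) (2 * q),
      ‖weylSum L t‖ ^ 2 * (q * max 1 (L ^ 2 * |2 * t - a / q|)) ≤
        1683 * (∑' j : ℤ, (1 + (j : ℝ) ^ 2)⁻¹) * L ^ 4 := by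
  obtain ⟨q, hqmem, a, hcop, hlt⟩ := exists_isCoprime_mul_abs_sub_lt_one hL (2 * t)
  obtain ⟨hq, hqL⟩ := mem_Icc.1 hqmem
  have hL' : (1 : ℝ) ≤ L := by exact_mod_cast hL
  have hlt' : |q * (2 * t) - a| < 1 := (le_mul_of_one_le_left (abs_nonneg _) hL').trans_lt hlt
  refine ⟨q, hqmem, a, mem_Icc_of_abs_mul_sub_lt_one ht hlt', ?_⟩
  rw [← mul_approxScale hL hq, mul_left_comm]
  linarith [mul_le_mul_of_nonneg_left
    (norm_weylSum_sq_mul_approxScale_le hL hq hqL hcop hlt.le) L.cast_nonneg]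

/-- A sum of bumps of width `L⁻²` around the points `a / (2q)` with `q ≤ L`, dominating the `s`-th
power of the Weyl sum up to a factor `L ^ (2s)`. -/
def weylMajorant (L : ℕ) (s t : ℝ) : ℝ :=
  ∑ q ∈ Icc 1 L, ∑ a ∈ Icc (0 : ℤ) (2 * q),
    (q : ℝ) ^ (-(s / 2)) * (1 + (L ^ 2 * (2 * t - a / q)) ^ 2)⁻¹

theorem continuous_mul_inv_one_add_sq_affine (b c x₀ : ℝ) :
    Continuous fun t : ℝ ↦ b * (1 + (c * (2 * t - x₀)) ^ 2)⁻¹ :=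
  continuous_const.mul (Continuous.inv₀ (by fun_prop) fun t ↦ by positivity)

theorem continuous_weylMajorant (L : ℕ) (s : ℝ) : Continuous (weylMajorant L s) :=
  continuous_finsetSum _ fun _ _ ↦ continuous_finsetSum _ fun _ _ ↦
    continuous_mul_inv_one_add_sq_affine _ _ _

theorem inv_max_one_abs_rpow_le {x : ℝ} (hs : 4 ≤ s) :
    ((max 1 |x|) ^ (s / 2))⁻¹ ≤ 2 * (1 + x ^ 2)⁻¹ := by
  have hone : 1 ≤ max 1 |x| := le_max_left _ _
  have hpow : max 1 |x| ^ 2 ≤ max 1 |x| ^ (s / 2) := by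
    rw [← Real.rpow_two]
    exact Real.rpow_le_rpow_of_exponent_le hone (by linarith)
  have hsq : x ^ 2 ≤ max 1 |x| ^ 2 := sq_le_sq.2 (le_abs.2 (Or.inl (le_max_right _ _)))
  rw [← div_eq_mul_inv, inv_le_comm₀ (by positivity) (by positivity), inv_div]
  linarith [one_le_pow₀ hone (n := 2)]

theorem norm_weylSum_rpow_le (hs : 4 ≤ s) (hL : 0 < L) (ht : t ∈ Set.Icc (0 : ℝ) 1) :
    ‖weylSum L t‖ ^ s ≤ 2 * (1683 * ∑' j : ℤ, (1 + (j : ℝ) ^ 2)⁻¹) ^ (s / 2) *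
      (L : ℝ) ^ (2 * s) * weylMajorant L s t := by
  set κ : ℝ := 1683 * ∑' j : ℤ, (1 + (j : ℝ) ^ 2)⁻¹
  have hκ : 0 ≤ κ := mul_nonneg (by norm_num) (tsum_nonneg fun _ ↦ by positivity)
  obtain ⟨q, hq, a, ha, hW⟩ := exists_norm_weylSum_sq_le hL ht
  have hq' : (0 : ℝ) < q := by exact_mod_cast (mem_Icc.1 hq).1
  set x : ℝ := L ^ 2 * (2 * t - a / q) with hx
  have hx' : (L : ℝ) ^ 2 * |2 * t - a / q| = |x| := by
    rw [hx, abs_mul, abs_of_nonneg (sq_nonneg (L : ℝ))]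
  rw [hx', ← le_div_iff₀ (by positivity)] at hW
  calc ‖weylSum L t‖ ^ s = (‖weylSum L t‖ ^ 2) ^ (s / 2) := by
        rw [← Real.rpow_two, ← Real.rpow_mul (norm_nonneg _), mul_div_cancel₀ _ two_ne_zero]
    _ ≤ (κ * L ^ 4 / (q * max 1 |x|)) ^ (s / 2) := by gcongr
    _ = κ ^ (s / 2) * (L : ℝ) ^ (2 * s) * ((q : ℝ) ^ (-(s / 2)) * ((max 1 |x|) ^ (s / 2))⁻¹) := by
        rw [Real.div_rpow (by positivity) (by positivity), Real.mul_rpow hκ (by positivity),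
          Real.mul_rpow hq'.le (by positivity), Real.rpow_neg hq'.le, ← Real.rpow_natCast,
          ← Real.rpow_mul L.cast_nonneg, div_eq_mul_inv, mul_inv]
        congr 3
        push_cast
        ring
    _ ≤ κ ^ (s / 2) * (L : ℝ) ^ (2 * s) * ((q : ℝ) ^ (-(s / 2)) * (2 * (1 + x ^ 2)⁻¹)) := by
        gcongr
        exact inv_max_one_abs_rpow_le hs
    _ = 2 * κ ^ (s / 2) * (L : ℝ) ^ (2 * s) * ((q : ℝ) ^ (-(s / 2)) * (1 + x ^ 2)⁻¹) := by ring
    _ ≤ 2 * κ ^ (s / 2) * (L : ℝ) ^ (2 * s) * weylMajorant L s t := by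
        gcongr
        refine (single_le_sum (f := fun a : ℤ ↦ (q : ℝ) ^ (-(s / 2)) *
          (1 + (L ^ 2 * (2 * t - a / q)) ^ 2)⁻¹) (fun _ _ ↦ by positivity) ha).trans ?_
        exact single_le_sum (f := fun q : ℕ ↦ ∑ a ∈ Icc (0 : ℤ) (2 * q), (q : ℝ) ^ (-(s / 2)) *
          (1 + (L ^ 2 * (2 * t - a / q)) ^ 2)⁻¹) (fun _ _ ↦ sum_nonneg fun _ _ ↦ by positivity) hq

theorem integral_inv_one_add_sq_affine_le {c : ℝ} (hc : 0 < c) (x₀ : ℝ) :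
    ∫ t in (0 : ℝ)..1, (1 + (c * (2 * t - x₀)) ^ 2)⁻¹ ≤ Real.pi / (2 * c) := by
  have haffine (t : ℝ) : c * (2 * t - x₀) = 2 * c * t - c * x₀ := by ring
  simp only [haffine]
  rw [intervalIntegral.integral_comp_mul_sub (fun y : ℝ ↦ (1 + y ^ 2)⁻¹) (by positivity),
    integral_inv_one_add_sq, smul_eq_mul, inv_mul_eq_div]
  gcongr
  linarith [Real.arctan_lt_pi_div_two (2 * c * 1 - c * x₀),
    Real.neg_pi_div_two_lt_arctan (2 * c * 0 - c * x₀)]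

theorem integral_sum_inv_one_add_sq_le (hL : 0 < L) (hq : 0 < q) :
    ∫ t in (0 : ℝ)..1, ∑ a ∈ Icc (0 : ℤ) (2 * q), (q : ℝ) ^ (-(s / 2)) *
      (1 + (L ^ 2 * (2 * t - a / q)) ^ 2)⁻¹ ≤ 3 * Real.pi / L ^ 2 * (q : ℝ) ^ (1 - s / 2) := by
  have hq' : (1 : ℝ) ≤ q := by exact_mod_cast hq
  rw [intervalIntegral.integral_finsetSum fun a _ ↦
    (continuous_mul_inv_one_add_sq_affine _ _ _).intervalIntegrable _ _]
  simp only [intervalIntegral.integral_const_mul]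
  calc ∑ a ∈ Icc (0 : ℤ) (2 * q), (q : ℝ) ^ (-(s / 2)) *
        ∫ t in (0 : ℝ)..1, (1 + (L ^ 2 * (2 * t - a / q)) ^ 2 : ℝ)⁻¹
      ≤ ∑ a ∈ Icc (0 : ℤ) (2 * q), (q : ℝ) ^ (-(s / 2)) * (Real.pi / (2 * L ^ 2)) := by
        gcongr
        exact integral_inv_one_add_sq_affine_le (by positivity) _
    _ = (2 * q + 1) * ((q : ℝ) ^ (-(s / 2)) * (Real.pi / (2 * L ^ 2))) := by
        have hcard : #(Icc (0 : ℤ) (2 * q)) = 2 * q + 1 := by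
          rw [Int.card_Icc]
          omega
        rw [sum_const, hcard, nsmul_eq_mul]
        push_cast
        rfl
    _ ≤ 6 * q * ((q : ℝ) ^ (-(s / 2)) * (Real.pi / (2 * L ^ 2))) := by
        gcongr
        linarith
    _ = _ := by
        rw [sub_eq_add_neg, Real.rpow_add (by positivity), Real.rpow_one]
        ring

theorem integral_weylMajorant_le (hs : 4 < s) (hL : 0 < L) :
    ∫ t in (0 : ℝ)..1, weylMajorant L s t ≤
      3 * Real.pi / L ^ 2 * ∑' q : ℕ, (q : ℝ) ^ (1 - s / 2) := by
  simp only [weylMajorant]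
  rw [intervalIntegral.integral_finsetSum fun q _ ↦ (continuous_finsetSum _ fun a _ ↦
    continuous_mul_inv_one_add_sq_affine _ _ _).intervalIntegrable _ _]
  refine (sum_le_sum fun q hq ↦ integral_sum_inv_one_add_sq_le hL (mem_Icc.1 hq).1).trans ?_
  rw [← mul_sum]
  gcongr
  exact (Real.summable_nat_rpow.2 (by linarith)).sum_le_tsum _ fun _ _ ↦ by positivity

theorem continuous_weylSum (L : ℕ) : Continuous (weylSum L) :=
  continuous_finsetSum _ fun _ _ ↦ Continuous.smul
    (continuous_const.mul
      (continuous_subtype_val.comp (Real.continuous_fourierChar.comp (by fun_prop))))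
    continuous_const

theorem exists_integral_norm_weylSum_rpow_le (hs : 4 < s) :
    ∃ C, ∀ L : ℕ, 0 < L → ∫ t in (0 : ℝ)..1, ‖weylSum L t‖ ^ s ≤ C * (L : ℝ) ^ (2 * s - 2) := by
  refine ⟨2 * (1683 * ∑' j : ℤ, (1 + (j : ℝ) ^ 2)⁻¹) ^ (s / 2) *
    (3 * Real.pi * ∑' q : ℕ, (q : ℝ) ^ (1 - s / 2)), fun L hL ↦ ?_⟩
  have hL' : (0 : ℝ) < L := by exact_mod_cast hL
  set κ : ℝ := 1683 * ∑' j : ℤ, (1 + (j : ℝ) ^ 2)⁻¹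
  calc ∫ t in (0 : ℝ)..1, ‖weylSum L t‖ ^ s
      ≤ ∫ t in (0 : ℝ)..1, 2 * κ ^ (s / 2) * (L : ℝ) ^ (2 * s) * weylMajorant L s t :=
        intervalIntegral.integral_mono_on zero_le_one
          (((continuous_weylSum L).norm.rpow_const fun _ ↦ .inr (by linarith)).intervalIntegrable
            _ _)
          ((continuous_const.mul (continuous_weylMajorant L s)).intervalIntegrable _ _)
          fun t ht ↦ norm_weylSum_rpow_le hs.le hL ht
    _ ≤ 2 * κ ^ (s / 2) * (L : ℝ) ^ (2 * s) *
          (3 * Real.pi / L ^ 2 * ∑' q : ℕ, (q : ℝ) ^ (1 - s / 2)) := by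
        rw [intervalIntegral.integral_const_mul]
        gcongr
        exact integral_weylMajorant_le hs hL
    _ = _ := by
        rw [Real.rpow_sub hL', Real.rpow_two]
        ring

end WeylMoment

theorem integral_fourierChar_mul_int (n : ℤ) :
    ∫ t in (0 : ℝ)..1, (𝐞 (t * n) : ℂ) = if n = 0 then 1 else 0 := by
  split_ifs with h
  · simp [h]
  have hc : (2 * Real.pi * n * Complex.I : ℂ) ≠ 0 := by simp [h, Real.pi_ne_zero]
  have hexp (t : ℝ) : (𝐞 (t * n) : ℂ) = Complex.exp (2 * Real.pi * n * Complex.I * t) := by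
    rw [Real.fourierChar_apply]
    congr 1
    push_cast
    ring
  simp only [hexp]
  rw [integral_exp_mul_complex hc, div_eq_zero_iff, sub_eq_zero]
  left
  rw [Complex.ofReal_zero, mul_zero, Complex.exp_zero, Complex.ofReal_one, mul_one,
    Complex.exp_eq_one_iff]
  exact ⟨n, by ring⟩

section TrigPoly

open UnitAddTorus

variable {ι : Type*} [Fintype ι]

theorem volume_unitAddTorus_eq_pi_haar :
    (volume : Measure (UnitAddTorus ι)) =
      Measure.pi fun _ ↦ (AddCircle.haarAddCircle : Measure UnitAddCircle) := by
  have hcircle : (volume : Measure UnitAddCircle) = AddCircle.haarAddCircle := by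
    rw [AddCircle.volume_eq_smul_haarAddCircle, ENNReal.ofReal_one, one_smul]
  rw [volume_pi, hcircle]

instance isProbabilityMeasure_volume_unitAddTorus :
    IsProbabilityMeasure (volume : Measure (UnitAddTorus ι)) := by
  rw [volume_unitAddTorus_eq_pi_haar]
  infer_instance

theorem mFourierCoeff_eq_integral_volume (g : UnitAddTorus ι → ℂ) (k : ι → ℤ) :
    mFourierCoeff g k = ∫ x, mFourier (-k) x * g x := by
  rw [volume_unitAddTorus_eq_pi_haar]
  rfl

theorem sum_sq_norm_mFourierCoeff_le {g : UnitAddTorus ι → ℂ} (hg : MemLp g 2 volume)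
    (u : Finset (ι → ℤ)) : ∑ k ∈ u, ‖mFourierCoeff g k‖ ^ 2 ≤ ∫ x, ‖g x‖ ^ 2 := by
  rw [volume_unitAddTorus_eq_pi_haar] at hg ⊢
  have hsum := hasSum_sq_mFourierCoeff (hg.toLp g)
  have hcoeff (k : ι → ℤ) : mFourierCoeff (hg.toLp g) k = mFourierCoeff g k :=
    integral_congr_ae (by filter_upwards [hg.coeFn_toLp] with x hx; rw [hx])
  simp only [hcoeff] at hsum
  refine (sum_le_hasSum u (fun _ _ ↦ sq_nonneg _) hsum).trans_eq (integral_congr_ae ?_)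
  filter_upwards [hg.coeFn_toLp] with x hx
  rw [hx]

/-- The trigonometric polynomial `x ↦ ∑ k ∈ u, a k * e(k · x)` on the torus. -/
def trigPoly (u : Finset (ι → ℤ)) (a : (ι → ℤ) → ℂ) : C(UnitAddTorus ι, ℂ) :=
  ∑ k ∈ u, a k • mFourier k

theorem trigPoly_apply (u : Finset (ι → ℤ)) (a : (ι → ℤ) → ℂ) (x : UnitAddTorus ι) :
    trigPoly u a x = ∑ k ∈ u, a k * mFourier k x := by
  simp only [trigPoly, ContinuousMap.coe_sum, ContinuousMap.coe_smul, Finset.sum_apply,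
    Pi.smul_apply, smul_eq_mul]

theorem mFourier_sub_apply (k : ι → ℤ) (x y : UnitAddTorus ι) :
    mFourier k (x - y) = mFourier k x * mFourier (-k) y := by
  simp only [mFourier, ContinuousMap.coe_mk, ← prod_mul_distrib]
  refine prod_congr rfl fun i _ ↦ ?_
  rw [Pi.sub_apply, Pi.neg_apply, fourier_apply, fourier_apply, fourier_apply, smul_sub, neg_smul,
    sub_eq_add_neg, AddCircle.toCircle_add, Circle.coe_mul]

variable {g : UnitAddTorus ι → ℂ}

theorem integrable_continuousMap_mul (hg : Integrable g) (F : C(UnitAddTorus ι, ℂ)) :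
    Integrable fun x ↦ F x * g x :=
  hg.bdd_mul F.continuous.aestronglyMeasurable (.of_forall F.norm_coe_le_norm)

theorem norm_integral_continuousMap_mul_le (hg : Integrable g) (F : C(UnitAddTorus ι, ℂ)) :
    ‖∫ x, F x * g x‖ ≤ ‖F‖ * ∫ x, ‖g x‖ := by
  rw [← integral_const_mul]
  refine norm_integral_le_of_norm_le (hg.norm.const_mul _) (.of_forall fun x ↦ ?_)
  rw [norm_mul]
  gcongr
  exact F.norm_coe_le_norm x

theorem sum_mul_conj_mFourierCoeff (hg : Integrable g) (u : Finset (ι → ℤ)) (a : (ι → ℤ) → ℂ) :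
    ∑ k ∈ u, a k * conj (mFourierCoeff g k) = ∫ x, trigPoly u a x * conj (g x) := by
  have hg' : Integrable fun x ↦ conj (g x) :=
    (LinearIsometryEquiv.integrable_comp_iff RCLike.conjLIE).2 hg
  simp only [trigPoly_apply, sum_mul, mul_assoc]
  rw [integral_finsetSum _ fun k _ ↦ (integrable_continuousMap_mul hg' (mFourier k)).const_mul _]
  refine sum_congr rfl fun k _ ↦ ?_
  rw [integral_const_mul, mFourierCoeff_eq_integral_volume, ← integral_conj]
  simp only [map_mul, mFourier_neg, Complex.conj_conj]

theorem trigPoly_mul_mFourierCoeff_apply (hg : Integrable g) (u : Finset (ι → ℤ))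
    (c : (ι → ℤ) → ℂ) (x : UnitAddTorus ι) :
    trigPoly u (fun k ↦ c k * mFourierCoeff g k) x = ∫ y, trigPoly u c (x - y) * g y := by
  simp only [trigPoly_apply, mFourier_sub_apply, sum_mul, ← mul_assoc]
  simp only [mul_assoc _ _ (g _)]
  rw [integral_finsetSum _ fun k _ ↦ (integrable_continuousMap_mul hg (mFourier (-k))).const_mul _]
  refine sum_congr rfl fun k _ ↦ ?_
  rw [integral_const_mul, mFourierCoeff_eq_integral_volume, mul_right_comm]

theorem norm_trigPoly_mul_mFourierCoeff_le (hg : Integrable g) (u : Finset (ι → ℤ))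
    (c : (ι → ℤ) → ℂ) :
    ‖trigPoly u fun k ↦ c k * mFourierCoeff g k‖ ≤ ‖trigPoly u c‖ * ∫ x, ‖g x‖ := by
  rw [ContinuousMap.norm_le _ (by positivity)]
  intro x
  rw [trigPoly_mul_mFourierCoeff_apply hg, ← integral_const_mul]
  refine norm_integral_le_of_norm_le (hg.norm.const_mul _) (.of_forall fun y ↦ ?_)
  rw [norm_mul]
  gcongr
  exact (trigPoly u c).norm_coe_le_norm (x - y)

theorem norm_sum_mul_sq_norm_mFourierCoeff_le (hg : Integrable g) (u : Finset (ι → ℤ))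
    (c : (ι → ℤ) → ℂ) :
    ‖∑ k ∈ u, c k * (‖mFourierCoeff g k‖ ^ 2 : ℝ)‖ ≤ ‖trigPoly u c‖ * (∫ x, ‖g x‖) ^ 2 := by
  have hg' : Integrable fun x ↦ conj (g x) :=
    (LinearIsometryEquiv.integrable_comp_iff RCLike.conjLIE).2 hg
  calc ‖∑ k ∈ u, c k * (‖mFourierCoeff g k‖ ^ 2 : ℝ)‖
      = ‖∫ x, trigPoly u (fun k ↦ c k * mFourierCoeff g k) x * conj (g x)‖ := by
        rw [← sum_mul_conj_mFourierCoeff hg]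
        simp only [mul_assoc, Complex.mul_conj', Complex.ofReal_pow]
    _ ≤ ‖trigPoly u fun k ↦ c k * mFourierCoeff g k‖ * ∫ x, ‖conj (g x)‖ :=
        norm_integral_continuousMap_mul_le hg' _
    _ ≤ (‖trigPoly u c‖ * ∫ x, ‖g x‖) * ∫ x, ‖g x‖ := by
        simp only [RCLike.norm_conj]
        gcongr
        exact norm_trigPoly_mul_mFourierCoeff_le hg u c
    _ = _ := by ring

end TrigPoly

section LevelSums

variable {κ : Type*} (u : Finset κ) (q : κ → ℤ) (a : κ → ℂ)

theorem norm_sum_filter_eq_le_integral (n : ℤ) :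
    ‖∑ k ∈ u with q k = n, a k‖ ≤ ∫ t in (0 : ℝ)..1, ‖∑ k ∈ u, a k * 𝐞 (t * q k)‖ := by
  have hcont (k : κ) : Continuous fun t : ℝ ↦ a k * (𝐞 (t * (q k - n : ℤ)) : ℂ) :=
    continuous_const.mul
      (continuous_subtype_val.comp (Real.continuous_fourierChar.comp (by fun_prop)))
  have hphase (t : ℝ) : ‖∑ k ∈ u, a k * 𝐞 (t * (q k - n : ℤ))‖ =
      ‖∑ k ∈ u, a k * 𝐞 (t * q k)‖ := by
    have hk (k : κ) : a k * (𝐞 (t * (q k - n : ℤ)) : ℂ) = a k * 𝐞 (t * q k) * 𝐞 (-(t * n)) := by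
      rw [mul_assoc, ← Circle.coe_mul, ← AddChar.map_add_eq_mul]
      push_cast
      ring_nf
    simp only [hk, ← sum_mul]
    rw [norm_mul, Circle.norm_coe, mul_one]
  calc ‖∑ k ∈ u with q k = n, a k‖
      = ‖∫ t in (0 : ℝ)..1, ∑ k ∈ u, a k * 𝐞 (t * (q k - n : ℤ))‖ := by
        rw [intervalIntegral.integral_finsetSum fun k _ ↦ (hcont k).intervalIntegrable _ _]
        simp only [intervalIntegral.integral_const_mul, integral_fourierChar_mul_int, sub_eq_zero,
          mul_ite, mul_one, mul_zero, sum_filter]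
    _ ≤ ∫ t in (0 : ℝ)..1, ‖∑ k ∈ u, a k * 𝐞 (t * (q k - n : ℤ))‖ :=
        intervalIntegral.norm_integral_le_integral_norm zero_le_one
    _ = _ := by simp only [hphase]

theorem norm_sum_filter_mem_le_integral (W : Finset ℤ) :
    ‖∑ k ∈ u with q k ∈ W, a k‖ ≤ #W * ∫ t in (0 : ℝ)..1, ‖∑ k ∈ u, a k * 𝐞 (t * q k)‖ := by
  have hfiber : ∑ k ∈ u with q k ∈ W, a k = ∑ n ∈ W, ∑ k ∈ u with q k = n, a k := by
    simp only [sum_filter]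
    rw [sum_comm]
    simp only [sum_ite_eq]
  rw [hfiber, ← nsmul_eq_mul]
  exact (norm_sum_le _ _).trans
    (sum_le_card_nsmul _ _ _ fun n _ ↦ norm_sum_filter_eq_le_integral u q a n)

end LevelSums

section Annulus

variable {d : ℕ}

/-- The integer vectors with all coordinates in `[-L, L]`. -/
def latticeBox (d L : ℕ) : Finset (Fin d → ℤ) :=
  Fintype.piFinset fun _ ↦ Icc (-L : ℤ) L

/-- The squared Euclidean length of an integer vector, as an integer. -/
def latticeSq (k : Fin d → ℤ) : ℤ := ∑ i, k i ^ 2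

/-- The product of the tents of width `L` in each coordinate. -/
def tentWeight (L : ℕ) (k : Fin d → ℤ) : ℝ := ∏ i, (tent L (k i) : ℝ)

/-- The Fourier multiplier of the periodic Schrödinger evolution at time `t`, truncated by tents of
width `L`. -/
def schrodingerMultiplier (L : ℕ) (t : ℝ) (k : Fin d → ℤ) : ℂ :=
  tentWeight L k * 𝐞 (t * latticeSq k)

/-- The quadratic exponential sum `∑ k, w(k) b(k) e(t |k|²)` with tent weights `w`. -/
def quadSum (L : ℕ) (b : (Fin d → ℤ) → ℝ) (t : ℝ) : ℂ :=
  ∑ k ∈ latticeBox d L, schrodingerMultiplier L t k * b k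

theorem trigPoly_schrodingerMultiplier_apply (L : ℕ) (t : ℝ) (x : UnitAddTorus (Fin d)) :
    trigPoly (latticeBox d L) (schrodingerMultiplier L t) x = ∏ i, weylSum L t (x i) := by
  simp only [trigPoly_apply, weylSum_apply, prod_univ_sum, latticeBox]
  refine sum_congr rfl fun k _ ↦ ?_
  have hphase : (𝐞 (t * latticeSq k) : ℂ) = ∏ i, (𝐞 (t * k i ^ 2) : ℂ) := by
    rw [latticeSq, Int.cast_sum, mul_sum]
    push_cast
    exact map_prod (Circle.coeHom.comp 𝐞.toMonoidHom) (fun i ↦ Multiplicative.ofAdd _) _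
  rw [schrodingerMultiplier, hphase, tentWeight, prod_mul_distrib, prod_mul_distrib]
  push_cast
  rfl

theorem norm_trigPoly_schrodingerMultiplier_le (L : ℕ) (t : ℝ) :
    ‖trigPoly (latticeBox d L) (schrodingerMultiplier L t)‖ ≤ ‖weylSum L t‖ ^ d := by
  rw [ContinuousMap.norm_le _ (by positivity)]
  intro x
  rw [trigPoly_schrodingerMultiplier_apply, norm_prod]
  exact (prod_le_prod (fun _ _ ↦ norm_nonneg _) fun i _ ↦
    (weylSum L t).norm_coe_le_norm (x i)).trans_eq (by simp)

theorem tentWeight_nonneg (L : ℕ) (k : Fin d → ℤ) : 0 ≤ tentWeight L k :=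
  prod_nonneg fun i _ ↦ tent_nonneg L (k i)

theorem tentWeight_le (L : ℕ) (k : Fin d → ℤ) : tentWeight L k ≤ L ^ d := by
  have htent (i : Fin d) : (tent L (k i) : ℝ) ≤ L := by
    exact_mod_cast (show tent L (k i) ≤ L by unfold tent; lia)
  exact (prod_le_prod (fun i _ ↦ tent_nonneg L (k i)) fun i _ ↦ htent i).trans_eq (by simp)

theorem half_pow_le_tentWeight {L : ℕ} {k : Fin d → ℤ} (hk : ∀ i, |(k i : ℝ)| ≤ L / 2) :
    ((L : ℝ) / 2) ^ d ≤ tentWeight L k := by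
  have htent (i : Fin d) : (L : ℝ) / 2 ≤ tent L (k i) := by
    rw [tent]
    push_cast [Nat.cast_natAbs]
    exact le_max_of_le_right (by linarith [hk i])
  calc ((L : ℝ) / 2) ^ d = ∏ _i : Fin d, (L : ℝ) / 2 := by
        rw [prod_const, card_univ, Fintype.card_fin]
    _ ≤ tentWeight L k := prod_le_prod (fun _ _ ↦ by positivity) fun i _ ↦ htent i

theorem norm_quadSum_le (L : ℕ) {b : (Fin d → ℤ) → ℝ} (hb : ∀ k, 0 ≤ b k) (t : ℝ) :
    ‖quadSum L b t‖ ≤ L ^ d * ∑ k ∈ latticeBox d L, b k := by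
  rw [quadSum, mul_sum]
  refine norm_sum_le_of_le _ fun k _ ↦ ?_
  rw [schrodingerMultiplier, norm_mul, norm_mul, Circle.norm_coe, mul_one, Complex.norm_real,
    Complex.norm_real, Real.norm_of_nonneg (tentWeight_nonneg L k), Real.norm_of_nonneg (hb k)]
  exact mul_le_mul_of_nonneg_right (tentWeight_le L k) (hb k)

theorem continuous_quadSum (L : ℕ) (b : (Fin d → ℤ) → ℝ) : Continuous (quadSum L b) :=
  continuous_finsetSum _ fun _ _ ↦ (continuous_const.mul (continuous_subtype_val.comp
    (Real.continuous_fourierChar.comp (by fun_prop)))).mul continuous_const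

theorem abs_apply_le_latticeNorm (k : Fin d → ℤ) (i : Fin d) : |(k i : ℝ)| ≤ latticeNorm k :=
  Real.abs_le_sqrt (single_le_sum (f := fun j ↦ (k j : ℝ) ^ 2) (fun _ _ ↦ sq_nonneg _)
    (mem_univ i))

theorem latticeNorm_sq (k : Fin d → ℤ) : latticeNorm k ^ 2 = latticeSq k := by
  rw [latticeNorm, Real.sq_sqrt (by positivity), latticeSq]
  push_cast
  rfl

theorem mem_latticeBox_of_abs_le {L : ℕ} {k : Fin d → ℤ} (hk : ∀ i, |(k i : ℝ)| ≤ L) :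
    k ∈ latticeBox d L :=
  Fintype.mem_piFinset.2 fun i ↦ mem_Icc.2 (abs_le.1 (by exact_mod_cast hk i))

theorem card_Icc_ceil_floor_le (x : ℝ) {y : ℝ} (hy : 0 ≤ y) :
    (#(Icc ⌈x - y⌉ ⌊x + y⌋) : ℝ) ≤ 2 * y + 1 := by
  have hfloor := Int.floor_le (x + y)
  have hceil := Int.le_ceil (x - y)
  rw [Int.card_Icc, ← Int.cast_natCast (R := ℝ), Int.ofNat_toNat, Int.cast_max]
  refine max_le ?_ (by push_cast; positivity)
  push_cast
  linarith

variable {N R δ : ℝ}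

theorem latticeNorm_le_of_mem_annulus (hR : R ≤ N) (hδN : δ ≤ N) {k : Fin d → ℤ}
    (hk : k ∈ annulus d R δ) : latticeNorm k ≤ 3 / 2 * N := by
  have := (abs_le.1 (show |latticeNorm k - R| ≤ δ / 2 from hk)).2
  linarith

theorem abs_latticeSq_sub_sq_le (hR : R ≤ N) (hδN : δ ≤ N) {k : Fin d → ℤ}
    (hk : k ∈ annulus d R δ) : |(latticeSq k : ℝ) - R ^ 2| ≤ 2 * (N * δ) := by
  have hk' : |latticeNorm k - R| ≤ δ / 2 := hk
  have hk₀ : 0 ≤ latticeNorm k := Real.sqrt_nonneg _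
  have hδ : 0 ≤ δ / 2 := (abs_nonneg _).trans hk'
  have hsum : |latticeNorm k + R| ≤ 4 * N := by
    rw [abs_le] at hk' ⊢
    constructor <;> linarith
  calc |(latticeSq k : ℝ) - R ^ 2| = |latticeNorm k + R| * |latticeNorm k - R| := by
        rw [← latticeNorm_sq, sq_sub_sq, abs_mul]
    _ ≤ 4 * N * (δ / 2) := mul_le_mul hsum hk' (abs_nonneg _) ((abs_nonneg _).trans hsum)
    _ = 2 * (N * δ) := by ring

theorem sum_annulus_le_integral_norm_quadSum (hN : 0 < N) (hR : R ≤ N) (hδ : 1 / N ≤ δ)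
    (hδN : δ ≤ N) {L : ℕ} (hL : 4 * N ≤ L) {b : (Fin d → ℤ) → ℝ} (hb : ∀ k, 0 ≤ b k) :
    ((L : ℝ) / 2) ^ d * ∑ k ∈ (annulus_finite d R δ).toFinset, b k ≤
      5 * (N * δ) * ∫ t in (0 : ℝ)..1, ‖quadSum L b t‖ := by
  have hNδ : 1 ≤ N * δ := by rwa [div_le_iff₀' hN] at hδ
  set W := Icc ⌈R ^ 2 - 2 * (N * δ)⌉ ⌊R ^ 2 + 2 * (N * δ)⌋
  have hW : (#W : ℝ) ≤ 5 * (N * δ) :=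
    (card_Icc_ceil_floor_le _ (by positivity)).trans (by linarith)
  have hwb (k : Fin d → ℤ) : 0 ≤ tentWeight L k * b k := mul_nonneg (tentWeight_nonneg L k) (hb k)
  have hcoord {k : Fin d → ℤ} (hk : k ∈ annulus d R δ) (i : Fin d) : |(k i : ℝ)| ≤ L / 2 :=
    (abs_apply_le_latticeNorm k i).trans
      ((latticeNorm_le_of_mem_annulus hR hδN hk).trans (by linarith))
  have hsub : (annulus_finite d R δ).toFinset ⊆ {k ∈ latticeBox d L | latticeSq k ∈ W} := by
    intro k hk
    rw [Set.Finite.mem_toFinset] at hk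
    have hsq := abs_le.1 (abs_latticeSq_sub_sq_le hR hδN hk)
    exact mem_filter.2 ⟨mem_latticeBox_of_abs_le fun i ↦ (hcoord hk i).trans (by linarith),
      mem_Icc.2 ⟨Int.ceil_le.2 (by linarith), Int.le_floor.2 (by linarith)⟩⟩
  calc ((L : ℝ) / 2) ^ d * ∑ k ∈ (annulus_finite d R δ).toFinset, b k
      ≤ ∑ k ∈ (annulus_finite d R δ).toFinset, tentWeight L k * b k := by
        rw [mul_sum]
        refine sum_le_sum fun k hk ↦ mul_le_mul_of_nonneg_right (half_pow_le_tentWeight ?_) (hb k)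
        exact hcoord ((Set.Finite.mem_toFinset _).1 hk)
    _ ≤ ∑ k ∈ latticeBox d L with latticeSq k ∈ W, tentWeight L k * b k :=
        sum_le_sum_of_subset_of_nonneg hsub fun k _ _ ↦ hwb k
    _ = ‖∑ k ∈ latticeBox d L with latticeSq k ∈ W, (tentWeight L k * b k : ℂ)‖ := by
        rw [← Real.norm_of_nonneg (sum_nonneg fun k _ ↦ hwb k), ← Complex.norm_real]
        push_cast
        rfl
    _ ≤ #W * ∫ t in (0 : ℝ)..1, ‖∑ k ∈ latticeBox d L,
          (tentWeight L k * b k : ℂ) * 𝐞 (t * latticeSq k)‖ :=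
        norm_sum_filter_mem_le_integral _ _ _ _
    _ = #W * ∫ t in (0 : ℝ)..1, ‖quadSum L b t‖ := by
        simp only [quadSum, schrodingerMultiplier, mul_right_comm]
    _ ≤ _ := by
        gcongr
        exact intervalIntegral.integral_nonneg zero_le_one fun _ _ ↦ norm_nonneg _

theorem exists_sum_annulus_le (d : ℕ) {s : ℝ} (hs : 4 < s) :
    ∃ C, 0 ≤ C ∧ ∀ N R δ : ℝ, 0 < N → R ≤ N → 1 / N ≤ δ → δ ≤ N → ∀ L : ℕ, 4 * N ≤ L → L ≤ 5 * N →
      ∀ (V : ℝ) (b : (Fin d → ℤ) → ℝ), 0 ≤ V → (∀ k, 0 ≤ b k) →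
      (∀ t, ‖quadSum L b t‖ ≤ V * (L : ℝ) ^ (d - s) * ‖weylSum L t‖ ^ s) →
      ∑ k ∈ (annulus_finite d R δ).toFinset, b k ≤ C * V * (N ^ (s - 1) * δ) := by
  obtain ⟨C, hC⟩ := exists_integral_norm_weylSum_rpow_le hs
  refine ⟨2 ^ d * 5 * |C| * 5 ^ (s - 2), by positivity,
    fun N R δ hN hR hδ hδN L hL hL5 V b hV hb hbV ↦ ?_⟩
  have hδ₀ : 0 < δ := lt_of_lt_of_le (by positivity) hδ
  have hL₀ : (0 : ℝ) < L := by linarith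
  have hmoment : ∫ t in (0 : ℝ)..1, ‖quadSum L b t‖ ≤
      V * (L : ℝ) ^ (d - s) * (|C| * (L : ℝ) ^ (2 * s - 2)) := by
    calc ∫ t in (0 : ℝ)..1, ‖quadSum L b t‖
        ≤ ∫ t in (0 : ℝ)..1, V * (L : ℝ) ^ (d - s) * ‖weylSum L t‖ ^ s :=
          intervalIntegral.integral_mono zero_le_one
            ((continuous_quadSum L b).norm.intervalIntegrable _ _)
            ((continuous_const.mul ((continuous_weylSum L).norm.rpow_const
              fun _ ↦ .inr (by linarith))).intervalIntegrable _ _) hbV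
      _ ≤ _ := by
          rw [intervalIntegral.integral_const_mul]
          gcongr
          exact (hC L (by exact_mod_cast hL₀)).trans (by gcongr; exact le_abs_self C)
  refine le_of_mul_le_mul_left ?_ (by positivity : 0 < ((L : ℝ) / 2) ^ d)
  calc ((L : ℝ) / 2) ^ d * ∑ k ∈ (annulus_finite d R δ).toFinset, b k
      ≤ 5 * (N * δ) * (V * (L : ℝ) ^ (d - s) * (|C| * (L : ℝ) ^ (2 * s - 2))) :=
        (sum_annulus_le_integral_norm_quadSum hN hR hδ hδN hL hb).trans (by gcongr)
    _ = 5 * |C| * V * (N * δ) * ((L : ℝ) ^ d * (L : ℝ) ^ (s - 2)) := by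
        rw [← Real.rpow_natCast, ← Real.rpow_add hL₀,
          show (d : ℝ) + (s - 2) = d - s + (2 * s - 2) by ring, Real.rpow_add hL₀]
        ring
    _ ≤ 5 * |C| * V * (N * δ) * ((L : ℝ) ^ d * (5 * N) ^ (s - 2)) := by
        gcongr
        linarith
    _ = _ := by
        rw [Real.mul_rpow (by positivity) hN.le, div_pow,
          show s - 1 = s - 2 + 1 by ring, Real.rpow_add_one hN.ne']
        field_simp

end Annulus

section Dispersive

open UnitAddTorus

variable {d : ℕ}

theorem norm_quadSum_sq_mFourierCoeff_le (L : ℕ) (t : ℝ) {g : UnitAddTorus (Fin d) → ℂ}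
    (hg : MemLp g 2 volume) {θ : ℝ} (hθ : 0 ≤ θ) (hθ1 : θ ≤ 1) :
    ‖quadSum L (fun k ↦ ‖mFourierCoeff g k‖ ^ 2) t‖ ≤
      (∫ x, ‖g x‖) ^ (2 * θ) * (∫ x, ‖g x‖ ^ 2) ^ (1 - θ) * (L : ℝ) ^ (d - d * θ) *
        ‖weylSum L t‖ ^ (d * θ) := by
  set Q := ‖quadSum L (fun k ↦ ‖mFourierCoeff g k‖ ^ 2) t‖
  have hQ₀ : 0 ≤ Q := norm_nonneg _
  have hdual : Q ≤ ‖weylSum L t‖ ^ d * (∫ x, ‖g x‖) ^ 2 :=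
    (norm_sum_mul_sq_norm_mFourierCoeff_le (hg.integrable one_le_two) _ _).trans
      (by gcongr; exact norm_trigPoly_schrodingerMultiplier_le L t)
  have hbessel : Q ≤ (L : ℝ) ^ d * ∫ x, ‖g x‖ ^ 2 :=
    (norm_quadSum_le L (fun _ ↦ sq_nonneg _) t).trans
      (by gcongr; exact sum_sq_norm_mFourierCoeff_le hg _)
  have hI : 0 ≤ ∫ x, ‖g x‖ := by positivity
  calc Q = Q ^ θ * Q ^ (1 - θ) := by
        rw [← Real.rpow_add_of_nonneg hQ₀ hθ (sub_nonneg.2 hθ1), add_sub_cancel, Real.rpow_one]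
    _ ≤ (‖weylSum L t‖ ^ d * (∫ x, ‖g x‖) ^ 2) ^ θ *
          ((L : ℝ) ^ d * ∫ x, ‖g x‖ ^ 2) ^ (1 - θ) := by
        have := sub_nonneg.2 hθ1
        gcongr
    _ = _ := by
        rw [Real.mul_rpow (by positivity) (by positivity),
          Real.mul_rpow (by positivity) (by positivity), ← Real.rpow_natCast_mul (norm_nonneg _),
          ← Real.rpow_natCast_mul hI, ← Real.rpow_natCast_mul (Nat.cast_nonneg L), mul_one_sub,
          Nat.cast_ofNat]
        ring

theorem exists_sum_annulus_sq_mFourierCoeff_le (d : ℕ) {θ : ℝ} (hθ : 4 < d * θ) (hθ1 : θ ≤ 1) :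
    ∃ C, 0 ≤ C ∧ ∀ N R δ : ℝ, 0 < N → R ≤ N → 1 / N ≤ δ → δ ≤ N →
      ∀ g : UnitAddTorus (Fin d) → ℂ, MemLp g 2 volume →
      ∑ k ∈ (annulus_finite d R δ).toFinset, ‖mFourierCoeff g k‖ ^ 2 ≤
        C * ((∫ x, ‖g x‖) ^ (2 * θ) * (∫ x, ‖g x‖ ^ 2) ^ (1 - θ)) * (N ^ (d * θ - 1) * δ) := by
  have hθ₀ : 0 < θ := pos_of_mul_pos_right (by linarith) (Nat.cast_nonneg d)
  obtain ⟨C, hC₀, hC⟩ := exists_sum_annulus_le d hθ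
  refine ⟨C, hC₀, fun N R δ hN hR hδ hδN g hg ↦ ?_⟩
  have hN1 : 1 ≤ N := by
    have := (div_le_iff₀' hN).1 (hδ.trans hδN)
    nlinarith
  have hceil := Nat.ceil_lt_add_one (by positivity : 0 ≤ 4 * N)
  exact hC N R δ hN hR hδ hδN ⌈4 * N⌉₊ (Nat.le_ceil _) (by linarith) _ _ (by positivity)
    (fun _ ↦ sq_nonneg _) fun t ↦ norm_quadSum_sq_mFourierCoeff_le _ t hg hθ₀.le hθ1

end Dispersive

section LevelSets

variable {X : Type*} {F : X → ℂ} {α : ℝ}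

/-- The phase of `F`, cut off to the level set where `|F|` exceeds `α`. -/
def levelPhase (F : X → ℂ) (α : ℝ) : X → ℂ :=
  {x | α < ‖F x‖}.indicator fun x ↦ F x / ‖F x‖

theorem norm_levelPhase (hα : 0 ≤ α) (x : X) :
    ‖levelPhase F α x‖ = {x | α < ‖F x‖}.indicator 1 x := by
  by_cases hx : x ∈ {x | α < ‖F x‖}
  · rw [levelPhase, Set.indicator_of_mem hx, Set.indicator_of_mem hx, norm_div, Complex.norm_real,
      norm_norm, Pi.one_apply, div_self (hα.trans_lt hx).ne']
  · rw [levelPhase, Set.indicator_of_notMem hx, Set.indicator_of_notMem hx, norm_zero]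

theorem mul_conj_levelPhase (hα : 0 ≤ α) (x : X) :
    F x * conj (levelPhase F α x) = ({x | α < ‖F x‖}.indicator (fun x ↦ ‖F x‖) x : ℝ) := by
  by_cases hx : x ∈ {x | α < ‖F x‖}
  · have hFx : (‖F x‖ : ℂ) ≠ 0 := by exact_mod_cast (hα.trans_lt hx).ne'
    rw [levelPhase, Set.indicator_of_mem hx, Set.indicator_of_mem hx, map_div₀, Complex.conj_ofReal,
      ← mul_div_assoc, Complex.mul_conj', sq, mul_div_cancel_right₀ _ hFx]
  · rw [levelPhase, Set.indicator_of_notMem hx, Set.indicator_of_notMem hx, map_zero, mul_zero,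
      Complex.ofReal_zero]

variable [MeasurableSpace X] {μ : Measure X}

theorem measurable_levelPhase (hF : Measurable F) (α : ℝ) : Measurable (levelPhase F α) :=
  (hF.div (Complex.measurable_ofReal.comp hF.norm)).indicator
    (measurableSet_lt measurable_const hF.norm)

theorem memLp_levelPhase [IsFiniteMeasure μ] (hF : Measurable F) (hα : 0 ≤ α) (p : ℝ≥0∞) :
    MemLp (levelPhase F α) p μ :=
  .of_bound (measurable_levelPhase hF α).aestronglyMeasurable 1 <| .of_forall fun x ↦ by
    rw [norm_levelPhase hα]
    exact Set.indicator_le_self' (fun _ _ ↦ zero_le_one) x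

theorem integral_norm_levelPhase_pow (hF : Measurable F) (hα : 0 ≤ α) {n : ℕ} (hn : n ≠ 0) :
    ∫ x, ‖levelPhase F α x‖ ^ n ∂μ = μ.real {x | α < ‖F x‖} := by
  have hpow (x : X) : ‖levelPhase F α x‖ ^ n = {x | α < ‖F x‖}.indicator 1 x := by
    rw [norm_levelPhase hα]
    by_cases hx : α < ‖F x‖ <;> simp [hx, hn]
  simp only [hpow]
  exact integral_indicator_one (measurableSet_lt measurable_const hF.norm)

theorem mul_measureReal_le_norm_integral [IsFiniteMeasure μ] (hF : Measurable F)
    (hFi : Integrable F μ) (hα : 0 ≤ α) :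
    α * μ.real {x | α < ‖F x‖} ≤ ‖∫ x, F x * conj (levelPhase F α x) ∂μ‖ := by
  have hE : MeasurableSet {x | α < ‖F x‖} := measurableSet_lt measurable_const hF.norm
  simp only [mul_conj_levelPhase hα]
  rw [integral_complex_ofReal, Complex.norm_real, integral_indicator hE, mul_comm]
  refine le_trans ?_ (Real.le_norm_self _)
  rw [← smul_eq_mul, ← setIntegral_const]
  exact setIntegral_mono_on (integrable_const _).integrableOn hFi.norm.integrableOn hE
    fun _ hx ↦ le_of_lt hx

open UnitAddTorus

theorem mul_measureReal_trigPoly_le {ι : Type*} [Fintype ι] (u : Finset (ι → ℤ))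
    (a : (ι → ℤ) → ℂ) (hα : 0 ≤ α) :
    α * volume.real {x | α < ‖trigPoly u a x‖} ≤
      √(∑ k ∈ u, ‖a k‖ ^ 2) * √(∑ k ∈ u, ‖mFourierCoeff (levelPhase (trigPoly u a) α) k‖ ^ 2) := by
  have hF := (trigPoly u a).continuous
  have hFi : Integrable (trigPoly u a) :=
    hF.integrable_of_hasCompactSupport (.of_compactSpace _)
  have hg := (memLp_levelPhase (μ := volume) hF.measurable hα 2).integrable one_le_two
  calc α * volume.real {x | α < ‖trigPoly u a x‖}
      ≤ ‖∫ x, trigPoly u a x * conj (levelPhase (trigPoly u a) α x)‖ :=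
        mul_measureReal_le_norm_integral hF.measurable hFi hα
    _ ≤ ∑ k ∈ u, ‖a k‖ * ‖mFourierCoeff (levelPhase (trigPoly u a) α) k‖ := by
        rw [← sum_mul_conj_mFourierCoeff hg]
        exact norm_sum_le_of_le _ fun k _ ↦ by rw [norm_mul, RCLike.norm_conj]
    _ ≤ _ := Real.sum_mul_le_sqrt_mul_sqrt _ _ _

theorem specProj_eq_trigPoly {d : ℕ} (R δ : ℝ) (f : UnitAddTorus (Fin d) → ℂ) :
    specProj R δ f = trigPoly (annulus_finite d R δ).toFinset (mFourierCoeff f) := by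
  ext x
  rw [trigPoly_apply, specProj]

theorem exists_mul_measureReal_specProj_le (d : ℕ) {ρ : ℝ} (hρ : 0 ≤ ρ)
    (hdρ : 4 < d * (1 - 2 * ρ)) :
    ∃ C, 0 ≤ C ∧ ∀ N R δ : ℝ, 0 < N → R ≤ N → 1 / N ≤ δ → δ ≤ N →
      ∀ f : UnitAddTorus (Fin d) → ℂ, MemLp f 2 volume → ∀ α, 0 ≤ α →
      α * volume.real {x | α < ‖specProj R δ f x‖} ≤
        C * N ^ (((d : ℝ) - 1) / 2 - d * ρ) * δ ^ (1 / 2 : ℝ) * √(∫ x, ‖f x‖ ^ 2) *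
          volume.real {x | α < ‖specProj R δ f x‖} ^ (1 - ρ) := by
  obtain ⟨C, hC₀, hC⟩ := exists_sum_annulus_sq_mFourierCoeff_le d hdρ (by linarith)
  refine ⟨√C, Real.sqrt_nonneg _, fun N R δ hN hR hδ hδN f hf α hα ↦ ?_⟩
  have : 0 < δ := lt_of_lt_of_le (by positivity) hδ
  rw [specProj_eq_trigPoly]
  set F := trigPoly (annulus_finite d R δ).toFinset (mFourierCoeff f)
  set v := volume.real {x | α < ‖F x‖}
  have hFm := F.continuous.measurable
  have hθ : 0 < 1 - 2 * ρ := pos_of_mul_pos_right (by linarith) (Nat.cast_nonneg d)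
  have hrestricted := hC N R δ hN hR hδ hδN _ (memLp_levelPhase hFm hα 2)
  have hI : ∫ x, ‖levelPhase F α x‖ = v := by
    simpa only [pow_one] using integral_norm_levelPhase_pow hFm hα one_ne_zero
  rw [hI, integral_norm_levelPhase_pow hFm hα two_ne_zero,
    ← Real.rpow_add_of_nonneg measureReal_nonneg (by positivity) (by linarith)] at hrestricted
  calc α * v ≤ √(∫ x, ‖f x‖ ^ 2) *
        √(C * v ^ (2 * (1 - 2 * ρ) + (1 - (1 - 2 * ρ))) * (N ^ (d * (1 - 2 * ρ) - 1) * δ)) :=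
        (mul_measureReal_trigPoly_le _ _ hα).trans
          (by gcongr; exact sum_sq_norm_mFourierCoeff_le hf _)
    _ = _ := by
        rw [Real.sqrt_mul (by positivity), Real.sqrt_mul hC₀, Real.sqrt_mul (by positivity),
          Real.sqrt_eq_rpow (v ^ _), Real.sqrt_eq_rpow (N ^ _), Real.sqrt_eq_rpow δ,
          ← Real.rpow_mul measureReal_nonneg, ← Real.rpow_mul hN.le,
          show (2 * (1 - 2 * ρ) + (1 - (1 - 2 * ρ))) * (1 / 2) = 1 - ρ by ring,
          show ((d : ℝ) * (1 - 2 * ρ) - 1) * (1 / 2) = (d - 1) / 2 - d * ρ by ring]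
        ring

end LevelSets

section Interpolation

variable {X E : Type*} [MeasurableSpace X] [NormedAddCommGroup E] {μ : Measure X}
  [IsFiniteMeasure μ] {F : X → E}

theorem le_div_rpow_inv_of_mul_le {v α K ρ : ℝ} (hα : 0 < α) (hv : 0 ≤ v) (hK : 0 ≤ K)
    (hρ : 0 < ρ) (h : α * v ≤ K * v ^ (1 - ρ)) : v ≤ (K / α) ^ ρ⁻¹ := by
  rcases hv.eq_or_lt with rfl | hv
  · positivity
  have hvρ : v ^ ρ ≤ K / α := by
    rw [le_div_iff₀' hα]
    refine le_of_mul_le_mul_right ?_ (Real.rpow_pos_of_pos hv (1 - ρ))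
    rwa [mul_assoc, ← Real.rpow_add hv, add_sub_cancel, Real.rpow_one]
  rwa [Real.le_rpow_inv_iff_of_pos hv.le (by positivity) hρ]

theorem lintegral_measure_lt_mul_le {B K r P : ℝ} (hK : 0 ≤ K) (hFB : ∀ x, ‖F x‖ ≤ B)
    (hweak : ∀ α, 0 < α → μ.real {x | α < ‖F x‖} ≤ (K / α) ^ r) :
    ∫⁻ t in Set.Ioi (0 : ℝ), μ {x | t < ‖F x‖} * ENNReal.ofReal (t ^ (P - 1)) ≤
      ∫⁻ t in Set.Ioc (0 : ℝ) B, ENNReal.ofReal (K ^ r * t ^ (P - r - 1)) := by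
  rw [← lintegral_indicator measurableSet_Ioi, ← lintegral_indicator measurableSet_Ioc]
  refine lintegral_mono fun t ↦ ?_
  by_cases ht : t ∈ Set.Ioi (0 : ℝ)
  swap
  · rw [Set.indicator_of_notMem ht]
    exact zero_le
  have ht₀ : 0 < t := ht
  rw [Set.indicator_of_mem ht]
  by_cases htB : t ≤ B
  · rw [Set.indicator_of_mem (Set.mem_Ioc.2 ⟨ht, htB⟩), ← ofReal_measureReal,
      ← ENNReal.ofReal_mul measureReal_nonneg]
    refine ENNReal.ofReal_le_ofReal ((mul_le_mul_of_nonneg_right (hweak t ht₀)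
      (by positivity)).trans_eq ?_)
    rw [Real.div_rpow hK ht₀.le, show P - r - 1 = P - 1 - r by ring, Real.rpow_sub ht₀ _ r]
    ring
  · have hempty : {x | t < ‖F x‖} = ∅ :=
      Set.eq_empty_of_forall_notMem fun x hx ↦ htB (hx.le.trans (hFB x))
    rw [hempty, measure_empty, zero_mul]
    exact zero_le

theorem lintegral_rpow_le_of_weak_of_bounded (hF : AEStronglyMeasurable F μ) {B K r P : ℝ}
    (hB : 0 ≤ B) (hK : 0 ≤ K) (hFB : ∀ x, ‖F x‖ ≤ B) (hr : 0 < r) (hrP : r < P)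
    (hweak : ∀ α, 0 < α → μ.real {x | α < ‖F x‖} ≤ (K / α) ^ r) :
    ∫⁻ x, ENNReal.ofReal (‖F x‖ ^ P) ∂μ ≤
      ENNReal.ofReal (P / (P - r) * K ^ r * B ^ (P - r)) := by
  have hP : 0 < P := hr.trans hrP
  have hint : IntervalIntegrable (fun t : ℝ ↦ K ^ r * t ^ (P - r - 1)) volume 0 B :=
    (intervalIntegral.intervalIntegrable_rpow' (by linarith)).const_mul _
  have hnonneg : 0 ≤ᵐ[volume.restrict (Set.Ioc 0 B)] fun t : ℝ ↦ K ^ r * t ^ (P - r - 1) :=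
    ae_restrict_of_forall_mem measurableSet_Ioc fun t ht ↦
      mul_nonneg (by positivity) (Real.rpow_nonneg ht.1.le _)
  calc ∫⁻ x, ENNReal.ofReal (‖F x‖ ^ P) ∂μ
      = ENNReal.ofReal P *
          ∫⁻ t in Set.Ioi (0 : ℝ), μ {x | t < ‖F x‖} * ENNReal.ofReal (t ^ (P - 1)) :=
        lintegral_rpow_eq_lintegral_meas_lt_mul μ (.of_forall fun _ ↦ norm_nonneg _)
          hF.norm.aemeasurable hP
    _ ≤ ENNReal.ofReal P * ∫⁻ t in Set.Ioc (0 : ℝ) B, ENNReal.ofReal (K ^ r * t ^ (P - r - 1)) :=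
        mul_le_mul_right (lintegral_measure_lt_mul_le hK hFB hweak) _
    _ = ENNReal.ofReal (P * (K ^ r * ∫ t in (0 : ℝ)..B, t ^ (P - r - 1))) := by
        rw [← ofReal_integral_eq_lintegral_ofReal
          ((intervalIntegrable_iff_integrableOn_Ioc_of_le hB).1 hint) hnonneg,
          ← intervalIntegral.integral_of_le hB, intervalIntegral.integral_const_mul,
          ← ENNReal.ofReal_mul hP.le]
    _ = _ := by
        rw [integral_rpow (.inl (by linarith)), sub_add_cancel, Real.zero_rpow (by linarith)]
        ring_nf

theorem eLpNorm_le_of_weak_of_bounded {p : ℝ≥0∞} (hp : p ≠ 0) (hF : AEStronglyMeasurable F μ)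
    {B K ρ : ℝ} (hB : 0 ≤ B) (hK : 0 ≤ K) (hFB : ∀ x, ‖F x‖ ≤ B) (hρ : p.toReal⁻¹ < ρ)
    (hweak : ∀ α, 0 < α → μ.real {x | α < ‖F x‖} ≤ (K / α) ^ ρ⁻¹) :
    eLpNorm F p μ ≤ ENNReal.ofReal (((1 - p.toReal⁻¹ / ρ)⁻¹) ^ p.toReal⁻¹ *
      K ^ (p.toReal⁻¹ / ρ) * B ^ (1 - p.toReal⁻¹ / ρ)) := by
  have hρ₀ : 0 < ρ := (inv_nonneg.2 ENNReal.toReal_nonneg).trans_lt hρ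
  rcases eq_or_ne p ∞ with rfl | hp'
  · simp only [ENNReal.toReal_top, inv_zero, zero_div, sub_zero, Real.rpow_zero, Real.rpow_one,
      one_mul, eLpNorm_exponent_top]
    exact eLpNormEssSup_le_of_ae_bound (.of_forall hFB)
  have hP : 0 < p.toReal := ENNReal.toReal_pos hp hp'
  have hrP : ρ⁻¹ < p.toReal := inv_lt_of_inv_lt₀ hP hρ
  rw [eLpNorm_eq_lintegral_rpow_enorm_toReal hp hp', one_div]
  have henorm (x : X) : ‖F x‖ₑ ^ p.toReal = ENNReal.ofReal (‖F x‖ ^ p.toReal) := by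
    rw [← ofReal_norm, ENNReal.ofReal_rpow_of_nonneg (norm_nonneg _) hP.le]
  simp only [henorm]
  have : 0 < p.toReal - ρ⁻¹ := sub_pos.2 hrP
  refine (ENNReal.rpow_le_rpow (lintegral_rpow_le_of_weak_of_bounded hF hB hK hFB (inv_pos.2 hρ₀)
    hrP hweak) (inv_nonneg.2 hP.le)).trans_eq ?_
  have hfactor : p.toReal / (p.toReal - ρ⁻¹) = (1 - p.toReal⁻¹ / ρ)⁻¹ := by
    field_simp
  have hexp : (p.toReal - ρ⁻¹) * p.toReal⁻¹ = 1 - p.toReal⁻¹ / ρ := by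
    field_simp
  rw [ENNReal.ofReal_rpow_of_nonneg (by positivity) (inv_nonneg.2 hP.le),
    Real.mul_rpow (by positivity) (by positivity), Real.mul_rpow (by positivity) (by positivity),
    ← Real.rpow_mul hK, ← Real.rpow_mul hB, hfactor, hexp, inv_mul_eq_div ρ]

end Interpolation

section SpectralProjector

variable {d : ℕ}

theorem exists_norm_specProj_le (hd : 5 ≤ d) :
    ∃ C, 0 ≤ C ∧ ∀ N R δ : ℝ, 0 < N → R ≤ N → 1 / N ≤ δ → δ ≤ N →
      ∀ f : UnitAddTorus (Fin d) → ℂ, MemLp f 2 volume → ∀ x,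
      ‖specProj R δ f x‖ ≤
        C * N ^ (((d : ℝ) - 1) / 2) * δ ^ (1 / 2 : ℝ) * √(∫ x, ‖f x‖ ^ 2) := by
  have hd' : (4 : ℝ) < d := by exact_mod_cast hd
  obtain ⟨C, hC₀, hC⟩ := exists_mul_measureReal_specProj_le d le_rfl (by linarith)
  refine ⟨C, hC₀, fun N R δ hN hR hδ hδN f hf x ↦ ?_⟩
  have : 0 < δ := lt_of_lt_of_le (by positivity) hδ
  have hlevel := hC N R δ hN hR hδ hδN f hf
  simp only [mul_zero, sub_zero, Real.rpow_one] at hlevel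
  refine le_of_forall_lt_imp_le_of_dense fun α hα ↦ ?_
  rcases lt_or_ge α 0 with hα₀ | hα₀
  · exact hα₀.le.trans (by positivity)
  refine le_of_mul_le_mul_right (hlevel α hα₀) ?_
  have hopen : IsOpen {x | α < ‖specProj R δ f x‖} := by
    rw [specProj_eq_trigPoly]
    exact isOpen_lt continuous_const (ContinuousMap.continuous _).norm
  exact ENNReal.toReal_pos (hopen.measure_pos volume ⟨x, hα⟩).ne' (measure_ne_top _ _)

theorem eLpNorm_two_eq_ofReal_sqrt {X E : Type*} [MeasurableSpace X] {μ : Measure X}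
    [NormedAddCommGroup E] {f : X → E} (hf : MemLp f 2 μ) :
    eLpNorm f 2 μ = ENNReal.ofReal √(∫ x, ‖f x‖ ^ 2 ∂μ) := by
  simp [hf.eLpNorm_eq_integral_rpow_norm two_ne_zero ENNReal.ofNat_ne_top, Real.sqrt_eq_rpow]

theorem inv_toReal_lt_inv_of_ofReal_lt {x : ℝ} {p : ℝ≥0∞} (hx : 0 < x)
    (hp : ENNReal.ofReal x < p) : p.toReal⁻¹ < x⁻¹ := by
  rcases eq_or_ne p ∞ with rfl | hp'
  · simpa using hx
  · exact inv_strictAnti₀ hx ((ENNReal.ofReal_lt_iff_lt_toReal hx.le hp').1 hp)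

theorem mul_rpow_mul_rpow_one_sub {N C₁ C₂ D a b τ : ℝ} (hN : 0 < N) (hC₁ : 0 ≤ C₁)
    (hC₂ : 0 ≤ C₂) (hD : 0 ≤ D) (hτ : 0 ≤ τ) (hτ1 : τ ≤ 1) :
    (C₁ * N ^ a * D) ^ τ * (C₂ * N ^ b * D) ^ (1 - τ) =
      C₁ ^ τ * C₂ ^ (1 - τ) * N ^ (a * τ + b * (1 - τ)) * D := by
  have hDτ : D ^ τ * D ^ (1 - τ) = D := by
    rw [← Real.rpow_add_of_nonneg hD hτ (sub_nonneg.2 hτ1), add_sub_cancel, Real.rpow_one]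
  rw [Real.mul_rpow (by positivity) hD, Real.mul_rpow (by positivity) hD,
    Real.mul_rpow hC₁ (by positivity), Real.mul_rpow hC₂ (by positivity), ← Real.rpow_mul hN.le,
    ← Real.rpow_mul hN.le, Real.rpow_add hN]
  linear_combination C₁ ^ τ * C₂ ^ (1 - τ) * (N ^ (a * τ) * N ^ (b * (1 - τ))) * hDτ

theorem exists_eLpNorm_specProj_le (hd : 5 ≤ d) {p : ℝ≥0∞} (hp : p ≠ 0) {ρ : ℝ}
    (hpρ : p.toReal⁻¹ < ρ) (hdρ : 4 < d * (1 - 2 * ρ)) :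
    ∃ C, 0 ≤ C ∧ ∀ N R δ : ℝ, 0 < N → R ≤ N → 1 / N ≤ δ → δ ≤ N →
      ∀ f : UnitAddTorus (Fin d) → ℂ, MemLp f 2 volume → eLpNorm (specProj R δ f) p volume ≤
        ENNReal.ofReal (C * N ^ (((d : ℝ) - 1) / 2 - d / p.toReal) * δ ^ (1 / 2 : ℝ)) *
          eLpNorm f 2 volume := by
  have hp₀ : 0 ≤ p.toReal⁻¹ := inv_nonneg.2 ENNReal.toReal_nonneg
  have hρ : 0 < ρ := hp₀.trans_lt hpρ
  obtain ⟨C₁, hC₁, hweak⟩ := exists_mul_measureReal_specProj_le d hρ.le hdρ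
  obtain ⟨C₂, hC₂, hsup⟩ := exists_norm_specProj_le hd
  set τ := p.toReal⁻¹ / ρ with hτ
  have hτ₀ : 0 ≤ τ := by positivity
  have hτ1 : τ < 1 := (div_lt_one hρ).2 hpρ
  have : 0 ≤ (1 - τ)⁻¹ := inv_nonneg.2 (sub_nonneg.2 hτ1.le)
  refine ⟨(1 - τ)⁻¹ ^ p.toReal⁻¹ * (C₁ ^ τ * C₂ ^ (1 - τ)), by positivity,
    fun N R δ hN hR hδ hδN f hf ↦ ?_⟩
  have : 0 < δ := lt_of_lt_of_le (by positivity) hδ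
  have hexp : (((d : ℝ) - 1) / 2 - d * ρ) * τ + (d - 1) / 2 * (1 - τ) =
      (d - 1) / 2 - d / p.toReal := by
    rw [hτ]
    field_simp
    ring
  have hcont : Continuous (specProj R δ f) := by
    rw [specProj_eq_trigPoly]
    exact ContinuousMap.continuous _
  have hinterp := eLpNorm_le_of_weak_of_bounded hp hcont.aestronglyMeasurable (by positivity)
    (by positivity) (hsup N R δ hN hR hδ hδN f hf) hpρ fun α hα ↦
      le_div_rpow_inv_of_mul_le hα measureReal_nonneg (by positivity) hρ
        (hweak N R δ hN hR hδ hδN f hf α hα.le)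
  rw [eLpNorm_two_eq_ofReal_sqrt hf, ← ENNReal.ofReal_mul (by positivity), ← hexp]
  refine hinterp.trans_eq (congrArg ENNReal.ofReal ?_)
  rw [mul_assoc, mul_assoc _ (δ ^ _), mul_assoc _ (δ ^ _),
    mul_rpow_mul_rpow_one_sub hN hC₁ hC₂ (by positivity) hτ₀ hτ1.le]
  ring

end SpectralProjector

theorem theorem1p4_general (d : ℕ) (hd : 5 ≤ d) (p : ℝ≥0∞)
    (hp : ENNReal.ofReal (2 * (d : ℝ) / ((d : ℝ) - 4)) < p) (A : ℝ) (hA : 0 < A) :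
    ∃ C : ℝ, 0 < C ∧
      ∀ N R δ : ℝ, 0 < N → R ≤ A * N → 1 / (A * N) ≤ δ → δ ≤ A * N →
        ∀ f : UnitAddTorus (Fin d) → ℂ, MemLp f 2 volume →
          eLpNorm (specProj R δ f) p volume ≤
            ENNReal.ofReal
                (C * N ^ (((d : ℝ) - 1) / 2 - (d : ℝ) / p.toReal) * δ ^ (1 / 2 : ℝ)) *
              eLpNorm f 2 volume := by
  have hd' : (4 : ℝ) < d := by exact_mod_cast hd
  obtain ⟨ρ, hpρ, hρ⟩ := exists_between (inv_toReal_lt_inv_of_ofReal_lt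
    (div_pos (by linarith) (sub_pos.2 hd')) hp)
  have hdρ : 4 < d * (1 - 2 * ρ) := by
    rw [inv_div, lt_div_iff₀ (by linarith)] at hρ
    linarith
  obtain ⟨C, hC₀, hC⟩ := exists_eLpNorm_specProj_le hd (pos_of_gt hp).ne' hpρ hdρ
  refine ⟨(C + 1) * A ^ (((d : ℝ) - 1) / 2 - (d : ℝ) / p.toReal), by positivity,
    fun N R δ hN hR hδ hδN f hf ↦ (hC (A * N) R δ (by positivity) hR hδ hδN f hf).trans ?_⟩
  have : 0 < δ := lt_of_lt_of_le (by positivity) hδ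
  rw [mul_assoc (C + 1), ← Real.mul_rpow hA.le hN.le]
  gcongr
  exact (lt_add_one C).le

end

/-- `2d/(d-4) < p ≤ ∞`; for `p = ∞` the term `d / p.toReal` is `0`, as `d/p` should be.
The constant `A` is the one implicit in `radius ∼ N` and `δ ≳ 1/N`. -/
theorem theorem1p4 (d : ℕ) (hd : 5 ≤ d) (p : ℝ≥0∞)
    (hp : ENNReal.ofReal (2 * (d : ℝ) / ((d : ℝ) - 4)) < p) (A : ℝ) (hA : 1 ≤ A) :
    ∃ C : ℝ, 0 < C ∧
      ∀ N R δ : ℝ, 1 ≤ N → N / A ≤ R → R ≤ A * N → 1 / (A * N) ≤ δ → δ ≤ 1 →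
        ∀ f : UnitAddTorus (Fin d) → ℂ, MemLp f 2 volume →
          eLpNorm (specProj R δ f) p volume ≤
            ENNReal.ofReal
                (C * N ^ (((d : ℝ) - 1) / 2 - (d : ℝ) / p.toReal) * δ ^ (1 / 2 : ℝ)) *
              eLpNorm f 2 volume := by
  obtain ⟨C, hC₀, hC⟩ := theorem1p4_general d hd p hp A (one_pos.trans_le hA)
  exact ⟨C, hC₀, fun N R δ hN _ hR hδ hδ1 ↦
    hC N R δ (one_pos.trans_le hN) hR hδ (hδ1.trans (one_le_mul_of_one_le_of_one_le hA hN))⟩
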